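/- Let $\mathbb G$ be a Carnot group: a simply connected (finite-dimensional, real) Lie group whose Lie algebra has a stratification $\mathfrak g=V_1\oplus V_2\oplus\cdots\oplus V_s$ with $[V_1,V_j]=V_{j+1}$ for $j\ge 1$ (where $V_{s+1}=0$), endowed with its dilations $(\delta_t)_{t>0}$, where $\delta_t$ is the smooth automorphism of $\mathbb G$ whose differential is multiplication by $t^j$ on $V_j$. Elements of $\mathfrak g$ are regarded as left-invariant vector fields. Let $\mathrm{vol}$ be a Haar measure on $\mathbb G$, and let $\rho$ be the Carnot distance associated with a scalar product on $V_1$, i.e. $\rho(p,q)$ is the infimum of the lengths of the piecewise $C^1$ curves from $p$ to $q$ tangent to the left-invariant bundle defined by $V_1$; let $B_\rho(p,r)$ denote its open balls. Let $W\subset V_1$ be a horizontal half-space, i.e. $W=\{X\in V_1:\xi(X)\ge 0\}$ for some nonzero linear functional $\xi:V_1\to\mathbb R$, and let $S_W$ be the semigroup generated by $\exp(W)$. Let $E\subseteq\mathbb G$ be a measurable set that has constant normal with respect to $W$, i.e. for every $X\in W$ one has $X\mathbf 1_E\ge 0$ in the sense of distributions: $-\int_E Xu\,d\mathrm{vol}\ge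 0$ for all $u\in C_c^\infty(\mathbb G)$ with $u\ge 0$. Let $$\tilde E=\Bigl\{p\in\mathbb G:\ \lim_{r\to0^+}\frac{\mathrm{vol}(B_\rho(p,r)\cap E)}{\mathrm{vol}(B_\rho(p,r))}=1\Bigr\}$$ be the Carnot–Lebesgue representative of $E$. A cone is a nonempty set $C\subseteq\mathbb G$ with $\delta_t(C)=C$ for all $t>0$; a set $A\subseteq\mathbb G$ has the $C$-cone property if $A\cdot C\subseteq A$. Then: 1. $S_W$ is a cone (hence a conical semigroup) and has nonempty interior; 2. the closure $\mathrm{Cl}(S_W)$ is a cone and $\tilde E$ has the $\mathrm{Cl}(S_W)$-cone property; 3. $\tilde E$ is regularly open, i.e. $\tilde E=\mathrm{Int}(\mathrm{Cl}(\tilde E))$; 4. if $\mathrm{vol}(E)>0$, then $\tilde E$ is contractible (in particular nonempty); 5. if $\mathrm{vol}(\mathbb G\setminus E)>0$, then $\mathbb G\setminus\tilde E$ is contractible (in particular nonempty). -/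

import Mathlib

open Set Filter Topology MeasureTheory
open scoped Manifold ContDiff ENNReal Pointwise

noncomputable section

namespace Carnot

variable {E : Type*} [NormedAddCommGroup E] [NormedSpace ℝ E]
  {G : Type*} [TopologicalSpace G] [ChartedSpace E G] [Group G]

/-- `V` is a stratification `V 1 ⊕ V 2 ⊕ ⋯` of the Lie algebra of `G`:
`[V 1, V j] = V (j + 1)` for all `j ≥ 1`. The layers are indexed by all natural numbers; there is
no layer of index `0`, and if `G` is finite-dimensional then all but finitely many
layers vanish, because the sum is direct. -/
structure IsStratification (V : ℕ → Submodule ℝ (GroupLieAlgebra 𝓘(ℝ, E) G)) : Prop where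
  zero : V 0 = ⊥
  isInternal : DirectSum.IsInternal V
  bracket : ∀ j : ℕ, 1 ≤ j →
    Submodule.span ℝ {z | ∃ x ∈ V 1, ∃ y ∈ V j, z = ⁅x, y⁆} = V (j + 1)

/-- `δ t`, for `t > 0`, is the intrinsic dilation of factor `t`: the smooth group automorphism
whose differential sends every left-invariant vector field `X` of the layer `V j` to `t ^ j X`
(so it is the automorphism induced by the multiplication by `t` on `V 1`). The values
of `δ` at `t ≤ 0` are irrelevant. -/
structure IsDilationFamily (V : ℕ → Submodule ℝ (GroupLieAlgebra 𝓘(ℝ, E) G))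
    (δ : ℝ → G ≃* G) : Prop where
  contMDiff : ∀ t : ℝ, 0 < t → ContMDiff 𝓘(ℝ, E) 𝓘(ℝ, E) ∞ (δ t)
  mfderiv_eq : ∀ t : ℝ, 0 < t → ∀ j : ℕ, ∀ X ∈ V j, ∀ g : G,
    mfderiv 𝓘(ℝ, E) 𝓘(ℝ, E) (δ t) g (mulInvariantVectorField X g)
      = mulInvariantVectorField (t ^ j • X) (δ t g)

/-- A cone: a nonempty set which is invariant under all dilations. -/
def IsCone (δ : ℝ → G ≃* G) (C : Set G) : Prop :=
  C.Nonempty ∧ ∀ t : ℝ, 0 < t → δ t '' C = C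

/-- The (inner) `C`-cone property of `A`, for a cone `C`. -/
def HasConeProperty (δ : ℝ → G ≃* G) (C A : Set G) : Prop :=
  IsCone δ C ∧ A * C ⊆ A

/-- `W` is a closed half-space, through the origin, of the first layer `V 1`. -/
def IsHorizontalHalfSpace (V : ℕ → Submodule ℝ (GroupLieAlgebra 𝓘(ℝ, E) G))
    (W : Set (GroupLieAlgebra 𝓘(ℝ, E) G)) : Prop :=
  ∃ ξ : V 1 →ₗ[ℝ] ℝ, ξ ≠ 0 ∧ W = {X | ∃ h : X ∈ V 1, 0 ≤ ξ ⟨X, h⟩}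

/-- `exp W`: the points reached at time `1`, starting from the identity, along the integral
curves of the left-invariant vector fields in `W`. -/
def expSet (W : Set (GroupLieAlgebra 𝓘(ℝ, E) G)) : Set G :=
  {g | ∃ X ∈ W, ∃ γ : ℝ → G, γ 0 = 1 ∧
    IsMIntegralCurve (I := 𝓘(ℝ, E)) γ (mulInvariantVectorField X) ∧ γ 1 = g}

/-- The semigroup `S_W` generated by `exp W`. -/
def semigroupGen (W : Set (GroupLieAlgebra 𝓘(ℝ, E) G)) : Subsemigroup G :=
  Subsemigroup.closure (expSet W)

/-- The derivative `X u` of a function `u` along the left-invariant vector field `X`. -/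
def lieDeriv (X : GroupLieAlgebra 𝓘(ℝ, E) G) (u : G → ℝ) (g : G) : ℝ :=
  mfderiv 𝓘(ℝ, E) 𝓘(ℝ, ℝ) u g (mulInvariantVectorField X g)

/-- `X 𝟙_A ≥ 0` in the sense of distributions. -/
def IsMonotone [MeasurableSpace G] (μ : Measure G) (X : GroupLieAlgebra 𝓘(ℝ, E) G)
    (A : Set G) : Prop :=
  ∀ u : G → ℝ, ContMDiff 𝓘(ℝ, E) 𝓘(ℝ, ℝ) ∞ u → HasCompactSupport u → (∀ g, 0 ≤ u g) →
    0 ≤ -∫ g in A, lieDeriv X u g ∂μ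

/-- `A` is a measurable set with constant normal with respect to `W`. -/
def HasConstantNormal [MeasurableSpace G] (μ : Measure G)
    (W : Set (GroupLieAlgebra 𝓘(ℝ, E) G)) (A : Set G) : Prop :=
  NullMeasurableSet A μ ∧ ∀ X ∈ W, IsMonotone μ X A

/-- `γ`, restricted to `[0, 1]`, is a piecewise `C¹` horizontal curve with velocity `u`: it is
continuous and, outside a finite set of times, `γ' t` is the value at `γ t` of the
left-invariant vector field `u t ∈ V 1`, where `u` is continuous. -/
def IsHorizontalCurve (V : ℕ → Submodule ℝ (GroupLieAlgebra 𝓘(ℝ, E) G))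
    (γ : ℝ → G) (u : ℝ → V 1) : Prop :=
  ContinuousOn γ (Icc 0 1) ∧ ∃ F : Set ℝ, F.Finite ∧ ContinuousOn u (Ioo 0 1 \ F) ∧
    ∀ t ∈ Ioo (0 : ℝ) 1 \ F, HasMFDerivAt 𝓘(ℝ, ℝ) 𝓘(ℝ, E) γ t
      ((1 : ℝ →L[ℝ] ℝ).smulRight
        (mulInvariantVectorField (u t : GroupLieAlgebra 𝓘(ℝ, E) G) (γ t)))

/-- The Carnot distance associated with the scalar product `ip` on `V 1`: the infimum of the
lengths of the horizontal curves from `p` to `q`. -/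
def carnotDist (V : ℕ → Submodule ℝ (GroupLieAlgebra 𝓘(ℝ, E) G))
    (ip : InnerProductSpace.Core ℝ (V 1)) (p q : G) : ℝ≥0∞ :=
  ⨅ (γ : ℝ → G) (u : ℝ → V 1) (_ : IsHorizontalCurve V γ u) (_ : γ 0 = p) (_ : γ 1 = q),
    ∫⁻ t in Icc (0 : ℝ) 1, ENNReal.ofReal (Real.sqrt (ip.inner (u t) (u t)))

/-- The open ball of the Carnot distance. -/
def carnotBall (V : ℕ → Submodule ℝ (GroupLieAlgebra 𝓘(ℝ, E) G))
    (ip : InnerProductSpace.Core ℝ (V 1)) (p : G) (r : ℝ) : Set G :=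
  {q | carnotDist V ip p q < ENNReal.ofReal r}

/-- The Carnot–Lebesgue representative of `A`: the points at which `A` has density `1` with
respect to the Carnot distance. -/
def carnotLebesgueRep [MeasurableSpace G] (V : ℕ → Submodule ℝ (GroupLieAlgebra 𝓘(ℝ, E) G))
    (ip : InnerProductSpace.Core ℝ (V 1)) (μ : Measure G) (A : Set G) : Set G :=
  {p | Tendsto (fun r : ℝ => μ (carnotBall V ip p r ∩ A) / μ (carnotBall V ip p r))
    (𝓝[>] 0) (𝓝 1)}

/-- A regularly open set: it is the interior of its closure. -/
def IsRegularlyOpen {T : Type*} [TopologicalSpace T] (A : Set T) : Prop :=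
  A = interior (closure A)

end Carnot

end

/-!
Write `S` for the semigroup `S_W`, `O` for its interior, `γ_X` for the one-parameter subgroup with
generator `X` (`expCurve X`), and call a point essentially interior to `A` if almost all points of
some neighborhood belong to `A` (`essInterior`). The theorem follows from the fact that the
Carnot–Lebesgue representative of a set `A` with constant normal is its essential interior, which
is an open set stable under right multiplication by `S`.

*Interior points of `S`.* Neither a global exponential map nor the Baker–Campbell–Hausdorff formula
is used. Call a subspace `D` of the Lie algebra reachable if it is the image of the differential of
a `C¹` map into a left translate of `S` (`IsReachable`). A reachable subspace of maximal
dimension contains `Ad h X` for all `h ∈ S` and `X ∈ W`; as `W` and `-W` together cover `V 1`,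
differentiating `Ad (h γ_X(t)) Y` at `t = 0` shows inductively that it contains `Ad h (V j)` for all
`j`, so it is the whole Lie algebra (`isReachable_top`), and the inverse function theorem gives an
interior point (`exists_nonempty_interior_semigroupGen`). The subgroup generated by the `γ_X` with
`X ∈ V 1` is therefore open, hence everything. So the dilations form a continuous one-parameter
group of automorphisms, and the Carnot distance to the identity is a finite homogeneous gauge which
defines the topology (`isHomogeneousGauge_carnotDist`).

*Almost everywhere invariance.* The derivative of `t ↦ ∫_A u(g γ_X(t))` is the integral over `A` of
the derivative along `X` of a right translate of `u`, so it is nonpositive for `X ∈ W` and `u ≥ 0`.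
Applied to smooth cutoff functions, this says that `x * h ∈ A` for almost all `x ∈ A`, for each
`h ∈ S` (`HasConstantNormal.measure_diff_preimage`). By Fubini's theorem, right translation by an
element of `O` then sends the support of `A` into the essential interior of `A`
(`mul_mem_essInterior`). Applied to `A` and to its complement, with `S⁻¹` in place of `S`, this has
two consequences. As `O` accumulates at the identity, the essential interior is regularly open.
And if `p` is not essentially interior to `A`, then almost all of `p * O⁻¹` lies in the complement
of `A`; since `O⁻¹` is a dilation-invariant open set, `p * O⁻¹` fills a fixed proportion of each
ball centred at `p`, and `p` is not a point of density (`IsHomogeneousGauge.tendsto_density_iff`).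

*Contractibility.* A nonempty set which is stable under right multiplication by a cone with interior
points is contractible (`IsHomogeneousGauge.contractibleSpace`). This applies to the essential
interior with the cone `S`, and to its complement with the cone `S⁻¹`.
-/

namespace Carnot

section LieGroup

variable {E : Type*} [NormedAddCommGroup E] [NormedSpace ℝ E]
  {G : Type*} [TopologicalSpace G] [ChartedSpace E G] [Group G]

/-! ### Derivatives along left-invariant vector fields -/

/-- The regularity at which Mathlib states its results on left-invariant vector fields. -/
instance lieGroup_minSmoothness [LieGroup 𝓘(ℝ, E) ∞ G] :
    LieGroup 𝓘(ℝ, E) (minSmoothness ℝ 3) G :=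
  LieGroup.of_le (n := ∞) (by
    simp only [minSmoothness_of_isRCLikeNormedField]
    exact ENat.LEInfty.out)

instance isManifold_one [LieGroup 𝓘(ℝ, E) ∞ G] : IsManifold 𝓘(ℝ, E) 1 G :=
  IsManifold.of_le (n := ∞) (mod_cast le_top)

lemma hasDerivAt_comp_curve {v : G → ℝ} {γ : ℝ → G} {X : GroupLieAlgebra 𝓘(ℝ, E) G} {t : ℝ}
    (hv : MDifferentiableAt 𝓘(ℝ, E) 𝓘(ℝ, ℝ) v (γ t))
    (hγ : HasMFDerivAt 𝓘(ℝ, ℝ) 𝓘(ℝ, E) γ t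
      ((1 : ℝ →L[ℝ] ℝ).smulRight (mulInvariantVectorField X (γ t)))) :
    HasDerivAt (fun s => v (γ s)) (lieDeriv X v (γ t)) t := by
  have h0 : HasFDerivAt (fun s => v (γ s)) ((mfderiv 𝓘(ℝ, E) 𝓘(ℝ, ℝ) v (γ t) : E →L[ℝ] ℝ).comp
      ((1 : ℝ →L[ℝ] ℝ).smulRight (mulInvariantVectorField X (γ t) : E))) t :=
    hasMFDerivAt_iff_hasFDerivAt.1 (hv.hasMFDerivAt.comp t hγ)
  have h1 : HasDerivAt (fun s => v (γ s)) _ t := hasFDerivAt_iff_hasDerivAt.1 h0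
  refine h1.congr_deriv ?_
  exact congrArg (fun w : E => (mfderiv 𝓘(ℝ, E) 𝓘(ℝ, ℝ) v (γ t) : E →L[ℝ] ℝ) w)
    (one_smul ℝ (mulInvariantVectorField X (γ t) : E))

lemma lieDeriv_add (X Y : GroupLieAlgebra 𝓘(ℝ, E) G) (v : G → ℝ) (g : G) :
    lieDeriv (X + Y) v g = lieDeriv X v g + lieDeriv Y v g := by
  unfold lieDeriv
  rw [mulInvariantVectorField_add]
  exact map_add (mfderiv 𝓘(ℝ, E) 𝓘(ℝ, ℝ) v g) _ _

lemma lieDeriv_smul (c : ℝ) (X : GroupLieAlgebra 𝓘(ℝ, E) G) (v : G → ℝ) (g : G) :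
    lieDeriv (c • X) v g = c * lieDeriv X v g := by
  unfold lieDeriv
  rw [mulInvariantVectorField_smul]
  exact map_smul (mfderiv 𝓘(ℝ, E) 𝓘(ℝ, ℝ) v g) _ _

lemma hasCompactSupport_lieDeriv {v : G → ℝ} (hc : HasCompactSupport v)
    (X : GroupLieAlgebra 𝓘(ℝ, E) G) : HasCompactSupport (lieDeriv X v) := by
  refine hc.mono' fun g hg => ?_
  by_contra h
  apply hg
  have h1 : v =ᶠ[𝓝 g] fun _ => 0 := notMem_tsupport_iff_eventuallyEq.1 h
  unfold lieDeriv
  rw [h1.mfderiv_eq, mfderiv_const]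
  rfl

section LieDeriv

lemma lieDeriv_eq_sum [FiniteDimensional ℝ E] (v : G → ℝ) (g : G) (X : E) :
    lieDeriv (E := E) X v g = ∑ i, (Module.finBasis ℝ E).coord i X *
      lieDeriv (E := E) (Module.finBasis ℝ E i) v g := by
  let b := Module.finBasis ℝ E
  let Φ : E →ₗ[ℝ] ℝ :=
    { toFun := fun X => lieDeriv (E := E) X v g
      map_add' := fun X Y => lieDeriv_add X Y v g
      map_smul' := fun c X => lieDeriv_smul c X v g }
  change Φ X = ∑ i, b.coord i X * Φ (b i)
  conv_lhs => rw [← b.sum_repr X]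
  rw [map_sum]
  exact Finset.sum_congr rfl fun i _ => by rw [map_smul]; rfl

variable [LieGroup 𝓘(ℝ, E) ∞ G]

lemma contMDiff_one_mulInvariantVectorField (X : GroupLieAlgebra 𝓘(ℝ, E) G) :
    ContMDiff 𝓘(ℝ, E) 𝓘(ℝ, E).tangent 1
      (fun g : G => (⟨g, mulInvariantVectorField X g⟩ : TangentBundle 𝓘(ℝ, E) G)) :=
  (contMDiff_mulInvariantVectorField X).of_le
    (by simp only [minSmoothness_of_isRCLikeNormedField]; exact one_le_two)

lemma continuous_lieDeriv {v : G → ℝ} (hv : ContMDiff 𝓘(ℝ, E) 𝓘(ℝ, ℝ) ∞ v)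
    (X : GroupLieAlgebra 𝓘(ℝ, E) G) : Continuous (lieDeriv X v) := by
  have h1 : Continuous (tangentMap 𝓘(ℝ, E) 𝓘(ℝ, ℝ) v) := hv.continuous_tangentMap (by simp)
  have h2 := h1.comp (contMDiff_one_mulInvariantVectorField X).continuous
  have h3 := (contMDiff_snd_tangentBundle_modelSpace ℝ 𝓘(ℝ, ℝ) (n := ∞)).continuous
  exact h3.comp h2

/-- The derivative of a smooth compactly supported function along a left-invariant vector field
is bounded, uniformly for bounded vector fields. -/
lemma exists_forall_abs_lieDeriv_le [FiniteDimensional ℝ E] {v : G → ℝ}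
    (hv : ContMDiff 𝓘(ℝ, E) 𝓘(ℝ, ℝ) ∞ v) (hc : ∀ X, HasCompactSupport (lieDeriv (E := E) X v)) :
    ∃ M : ℝ, 0 ≤ M ∧ ∀ (X : E) (g : G), |lieDeriv (E := E) X v g| ≤ M * ‖X‖ := by
  let b := Module.finBasis ℝ E
  have h : ∀ i, ∃ C, ∀ g, ‖lieDeriv (E := E) (b i) v g‖ ≤ C := fun i =>
    (continuous_lieDeriv hv (b i)).bounded_above_of_compact_support (hc (b i))
  choose C hC using h
  let L : Fin (Module.finrank ℝ E) → (E →L[ℝ] ℝ) := fun i => (b.coord i).toContinuousLinearMap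
  refine ⟨∑ i, ‖L i‖ * |C i|, by positivity, fun X g => ?_⟩
  have hlin : lieDeriv (E := E) X v g = ∑ i, L i X * lieDeriv (E := E) (b i) v g :=
    lieDeriv_eq_sum v g X
  rw [hlin, Finset.sum_mul]
  refine (Finset.abs_sum_le_sum_abs _ _).trans (Finset.sum_le_sum fun i _ => ?_)
  rw [abs_mul]
  calc |L i X| * |lieDeriv (E := E) (b i) v g| ≤ (‖L i‖ * ‖X‖) * |C i| := by
        exact mul_le_mul ((L i).le_opNorm X) ((hC i g).trans (le_abs_self _)) (abs_nonneg _)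
          (by positivity)
    _ = ‖L i‖ * |C i| * ‖X‖ := by ring

end LieDeriv

/-! ### One-parameter subgroups -/

section Basic

lemma mulInvariantVectorField_one (X : GroupLieAlgebra 𝓘(ℝ, E) G) :
    mulInvariantVectorField X (1 : G) = X := by
  have h : HasMFDerivAt 𝓘(ℝ, E) 𝓘(ℝ, E) (fun x : G => 1 * x) 1
      (ContinuousLinearMap.id ℝ (TangentSpace 𝓘(ℝ, E) (1 : G))) := by
    have : (fun x : G => 1 * x) = id := by ext x; simp
    rw [this]
    exact hasMFDerivAt_id 1
  exact congrArg (fun L : E →L[ℝ] E => L X) h.mfderiv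

variable [LieGroup 𝓘(ℝ, E) ∞ G]

lemma mdifferentiableAt_mul_left (g h : G) :
    MDifferentiableAt 𝓘(ℝ, E) 𝓘(ℝ, E) (fun x : G => g * x) h :=
  (contMDiff_mul_left (I := 𝓘(ℝ, E)) (n := ∞)).mdifferentiableAt (by simp)

lemma mdifferentiableAt_mul_right (g h : G) :
    MDifferentiableAt 𝓘(ℝ, E) 𝓘(ℝ, E) (fun x : G => x * g) h :=
  (contMDiff_mul_right (I := 𝓘(ℝ, E)) (n := ∞)).mdifferentiableAt (by simp)

lemma mfderiv_mul_left_mulInvariantVectorField (X : GroupLieAlgebra 𝓘(ℝ, E) G) (g h : G) :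
    mfderiv 𝓘(ℝ, E) 𝓘(ℝ, E) (fun x : G => g * x) h (mulInvariantVectorField X h)
      = mulInvariantVectorField X (g * h) := by
  have h1 := mfderiv_comp_apply (I := 𝓘(ℝ, E)) (I' := 𝓘(ℝ, E)) (I'' := 𝓘(ℝ, E)) (1 : G)
    (f := fun x : G => h * x) (g := fun x : G => g * x)
    (mdifferentiableAt_mul_left g (h * 1)) (mdifferentiableAt_mul_left h 1) X
  have h2 : ((fun x : G => g * x) ∘ fun x : G => h * x) = fun x => (g * h) * x := by
    ext x; simp [mul_assoc]
  rw [h2] at h1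
  have h3 : ∀ k : G, k = h → (mfderiv 𝓘(ℝ, E) 𝓘(ℝ, E) (fun x : G => g * x) k : E →L[ℝ] E)
      = mfderiv 𝓘(ℝ, E) 𝓘(ℝ, E) (fun x : G => g * x) h := by
    rintro k rfl; rfl
  exact ((congrArg (fun L : E →L[ℝ] E => L (mulInvariantVectorField X h))
    (h3 _ (mul_one h))).symm.trans h1.symm)

lemma isMIntegralCurve_mul_left {γ : ℝ → G} {X : GroupLieAlgebra 𝓘(ℝ, E) G}
    (hγ : IsMIntegralCurve (I := 𝓘(ℝ, E)) γ (mulInvariantVectorField X)) (g : G) :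
    IsMIntegralCurve (I := 𝓘(ℝ, E)) (fun t => g * γ t) (mulInvariantVectorField X) := by
  intro t
  have h1 := ((mdifferentiableAt_mul_left (E := E) g (γ t)).hasMFDerivAt).comp t (hγ t)
  have h2 := mfderiv_mul_left_mulInvariantVectorField X g (γ t)
  refine h1.congr_mfderiv (ContinuousLinearMap.ext_ring ?_)
  change mfderiv 𝓘(ℝ, E) 𝓘(ℝ, E) (fun x : G => g * x) (γ t)
    ((1 : ℝ) • mulInvariantVectorField X (γ t)) = (1 : ℝ) • mulInvariantVectorField X (g * γ t)
  rw [one_smul, one_smul, h2]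

lemma isMIntegralCurve_eq [T2Space G] {γ γ' : ℝ → G} {X : GroupLieAlgebra 𝓘(ℝ, E) G}
    (hγ : IsMIntegralCurve (I := 𝓘(ℝ, E)) γ (mulInvariantVectorField X))
    (hγ' : IsMIntegralCurve (I := 𝓘(ℝ, E)) γ' (mulInvariantVectorField X))
    (h : γ 0 = γ' 0) : γ = γ' :=
  isMIntegralCurve_Ioo_eq_of_contMDiff_boundaryless (t₀ := 0)
    (contMDiff_one_mulInvariantVectorField X) hγ hγ' h

/-- Left-invariant vector fields are complete: by left-invariance, a local integral curve through
the identity yields integral curves through all points with a common time of existence. -/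
lemma exists_isMIntegralCurve_one [CompleteSpace E] [T2Space G] (X : GroupLieAlgebra 𝓘(ℝ, E) G) :
    ∃ γ : ℝ → G, γ 0 = 1 ∧ IsMIntegralCurve (I := 𝓘(ℝ, E)) γ (mulInvariantVectorField X) := by
  obtain ⟨γ, h0, hγ⟩ := exists_isMIntegralCurveAt_of_contMDiffAt_boundaryless
    (I := 𝓘(ℝ, E)) (t₀ := 0) (x₀ := (1 : G)) ((contMDiff_one_mulInvariantVectorField X) 1)
  obtain ⟨ε, hε, hγ⟩ := isMIntegralCurveAt_iff'.1 hγ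
  refine exists_isMIntegralCurve_of_isMIntegralCurveOn
    (contMDiff_one_mulInvariantVectorField X) hε (fun g => ⟨fun t => g * γ t, by simp [h0], ?_⟩) 1
  intro t ht
  have ht' : t ∈ Metric.ball (0 : ℝ) ε := by
    rw [Real.ball_eq_Ioo]; simpa using ht
  have h1 := ((mdifferentiableAt_mul_left (E := E) g (γ t)).hasMFDerivAt).comp_hasMFDerivWithinAt t
    (hγ t ht')
  have h2 := mfderiv_mul_left_mulInvariantVectorField X g (γ t)
  rw [Real.ball_eq_Ioo, zero_sub, zero_add] at h1
  refine h1.congr_mfderiv (ContinuousLinearMap.ext_ring ?_)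
  change mfderiv 𝓘(ℝ, E) 𝓘(ℝ, E) (fun x : G => g * x) (γ t)
    ((1 : ℝ) • mulInvariantVectorField X (γ t)) = (1 : ℝ) • mulInvariantVectorField X (g * γ t)
  rw [one_smul, one_smul, h2]

variable [CompleteSpace E] [T2Space G]

/-- The one-parameter subgroup `t ↦ exp (t X)`: the integral curve through the identity of the
left-invariant vector field `X`. -/
noncomputable def expCurve (X : GroupLieAlgebra 𝓘(ℝ, E) G) : ℝ → G :=
  (exists_isMIntegralCurve_one X).choose

@[simp]
lemma expCurve_zero (X : GroupLieAlgebra 𝓘(ℝ, E) G) : expCurve X 0 = 1 :=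
  (exists_isMIntegralCurve_one X).choose_spec.1

lemma isMIntegralCurve_expCurve (X : GroupLieAlgebra 𝓘(ℝ, E) G) :
    IsMIntegralCurve (I := 𝓘(ℝ, E)) (expCurve X) (mulInvariantVectorField X) :=
  (exists_isMIntegralCurve_one X).choose_spec.2

lemma eq_expCurve {γ : ℝ → G} {X : GroupLieAlgebra 𝓘(ℝ, E) G} (h : γ 0 = 1)
    (hγ : IsMIntegralCurve (I := 𝓘(ℝ, E)) γ (mulInvariantVectorField X)) : γ = expCurve X :=
  isMIntegralCurve_eq hγ (isMIntegralCurve_expCurve X) (by simp [h])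

lemma continuous_expCurve (X : GroupLieAlgebra 𝓘(ℝ, E) G) : Continuous (expCurve X) :=
  (isMIntegralCurve_expCurve X).continuous

lemma expCurve_add (X : GroupLieAlgebra 𝓘(ℝ, E) G) (s t : ℝ) :
    expCurve X (s + t) = expCurve X s * expCurve X t := by
  have h1 := (isMIntegralCurve_expCurve X).comp_add s
  have h2 := isMIntegralCurve_mul_left (isMIntegralCurve_expCurve X) (expCurve X s)
  have h3 := isMIntegralCurve_eq h1 h2 (by simp)
  simpa [add_comm] using congrFun h3 t

lemma expCurve_neg (X : GroupLieAlgebra 𝓘(ℝ, E) G) (t : ℝ) :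
    expCurve X (-t) = (expCurve X t)⁻¹ := by
  rw [eq_inv_iff_mul_eq_one, ← expCurve_add]; simp

lemma expCurve_smul (X : GroupLieAlgebra 𝓘(ℝ, E) G) (c t : ℝ) :
    expCurve (c • X) t = expCurve X (t * c) := by
  have h1 := (isMIntegralCurve_expCurve X).comp_mul c
  rw [← mulInvariantVectorField_smul] at h1
  exact (congrFun (eq_expCurve (by simp) h1) t).symm

lemma hasMFDerivAt_expCurve_zero (X : GroupLieAlgebra 𝓘(ℝ, E) G) :
    HasMFDerivAt 𝓘(ℝ, ℝ) 𝓘(ℝ, E) (expCurve X) 0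
      ((1 : ℝ →L[ℝ] ℝ).smulRight (X : E)) := by
  have := isMIntegralCurve_expCurve X 0
  have h2 : mulInvariantVectorField X (expCurve X 0) = (X : E) := by
    rw [expCurve_zero]; exact mulInvariantVectorField_one X
  rw [h2] at this
  exact this

lemma expSet_eq (W : Set (GroupLieAlgebra 𝓘(ℝ, E) G)) :
    expSet W = (fun X => expCurve X 1) '' W := by
  ext g
  constructor
  · rintro ⟨X, hX, γ, h0, hγ, rfl⟩
    exact ⟨X, hX, by rw [eq_expCurve h0 hγ]⟩
  · rintro ⟨X, hX, rfl⟩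
    exact ⟨X, hX, expCurve X, by simp, isMIntegralCurve_expCurve X, rfl⟩

lemma hasDerivAt_comp_mul_expCurve {v : G → ℝ} (hv : ContMDiff 𝓘(ℝ, E) 𝓘(ℝ, ℝ) ∞ v) (g : G)
    (X : GroupLieAlgebra 𝓘(ℝ, E) G) (t : ℝ) :
    HasDerivAt (fun s => v (g * expCurve X s)) (lieDeriv X v (g * expCurve X t)) t :=
  hasDerivAt_comp_curve (γ := fun s => g * expCurve X s) (hv.mdifferentiableAt (by simp))
    (isMIntegralCurve_mul_left (isMIntegralCurve_expCurve X) g t)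

lemma lieDeriv_mul_expCurve {v : G → ℝ} (hv : ContMDiff 𝓘(ℝ, E) 𝓘(ℝ, ℝ) ∞ v) (g : G)
    (X : GroupLieAlgebra 𝓘(ℝ, E) G) (t : ℝ) :
    lieDeriv X (fun x => v (x * expCurve X t)) g = lieDeriv X v (g * expCurve X t) := by
  have h1 := hasDerivAt_comp_mul_expCurve
    (hv.comp (contMDiff_mul_right (I := 𝓘(ℝ, E)) (a := expCurve X t))) g X 0
  have h2 := (hasDerivAt_comp_mul_expCurve hv g X (t + 0)).comp_const_add t 0
  have h3 : (fun s => v (g * expCurve X (t + s)))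
      = fun s => (v ∘ fun x => x * expCurve X t) (g * expCurve X s) := by
    ext s; simp [add_comm t s, expCurve_add, mul_assoc]
  rw [h3] at h2
  simpa [Function.comp_def] using h1.unique h2

end Basic

/-! ### The adjoint representation -/

section Calculus

/-- For a local multiplication `m` with unit `e`, the derivatives at `e` of the partial derivatives
`a ↦ ∂₂ m (a, e)` and `a ↦ ∂₁ m (e, a)` are transposed to each other. -/
lemma exists_hasFDerivAt_partial {m : E × E → E} {e : E} (hm : ContDiffAt ℝ 2 m (e, e)) :
    ∃ DA DR : E →L[ℝ] E →L[ℝ] E,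
      HasFDerivAt (fun a => fderiv ℝ (fun b => m (a, b)) e) DA e ∧
      HasFDerivAt (fun a => fderiv ℝ (fun b => m (b, a)) e) DR e ∧
      ∀ X Y, DR X Y = DA Y X := by
  have hd : ∀ᶠ p in 𝓝 (e, e), DifferentiableAt ℝ m p := by
    filter_upwards [hm.eventually (by simp)] with p hp using hp.differentiableAt (by simp)
  have hA : (fun a => fderiv ℝ (fun b => m (a, b)) e) =ᶠ[𝓝 e]
      fun a => (fderiv ℝ m (a, e)).comp (ContinuousLinearMap.inr ℝ E E) := by
    have : ContinuousAt (fun a : E => (a, e)) e := by fun_prop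
    filter_upwards [this.eventually hd] with a ha
    exact (ha.hasFDerivAt.comp e (hasFDerivAt_prodMk_right a e)).fderiv
  have hR : (fun a => fderiv ℝ (fun b => m (b, a)) e) =ᶠ[𝓝 e]
      fun a => (fderiv ℝ m (e, a)).comp (ContinuousLinearMap.inl ℝ E E) := by
    have : ContinuousAt (fun a : E => (e, a)) e := by fun_prop
    filter_upwards [this.eventually hd] with a ha
    exact (ha.hasFDerivAt.comp e (hasFDerivAt_prodMk_left e a)).fderiv
  have h2 : HasFDerivAt (fderiv ℝ m) (fderiv ℝ (fderiv ℝ m) (e, e)) (e, e) :=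
    ((hm.fderiv_right (m := 1) (by norm_num)).differentiableAt (by simp)).hasFDerivAt
  have hsymm : IsSymmSndFDerivAt ℝ m (e, e) :=
    hm.isSymmSndFDerivAt (by simp [minSmoothness_of_isRCLikeNormedField])
  let cA := (ContinuousLinearMap.compL ℝ E (E × E) E).flip (ContinuousLinearMap.inr ℝ E E)
  let cR := (ContinuousLinearMap.compL ℝ E (E × E) E).flip (ContinuousLinearMap.inl ℝ E E)
  refine ⟨cA.comp ((fderiv ℝ (fderiv ℝ m) (e, e)).comp (ContinuousLinearMap.inl ℝ E E)),
    cR.comp ((fderiv ℝ (fderiv ℝ m) (e, e)).comp (ContinuousLinearMap.inr ℝ E E)), ?_, ?_, ?_⟩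
  · refine HasFDerivAt.congr_of_eventuallyEq ?_ hA
    exact cA.hasFDerivAt.comp e
      (HasFDerivAt.comp (f := fun a : E => (a, e)) e h2 (hasFDerivAt_prodMk_left e e))
  · refine HasFDerivAt.congr_of_eventuallyEq ?_ hR
    exact cR.hasFDerivAt.comp e (h2.comp e (hasFDerivAt_prodMk_right e e))
  · intro X Y
    exact hsymm (0, X) (Y, 0)

lemma eventually_continuousAt_partial {m : E × E → E} {e : E} (hm : ContDiffAt ℝ 2 m (e, e)) :
    ∀ᶠ a in 𝓝 e, ContinuousAt (fun a => fderiv ℝ (fun b => m (a, b)) e) a := by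
  have hd : ∀ᶠ a in 𝓝 e, ContDiffAt ℝ 2 m (a, e) := by
    have : ContinuousAt (fun a : E => (a, e)) e := by fun_prop
    exact this.eventually (hm.eventually (by simp))
  filter_upwards [hd.eventually_nhds] with a ha
  have hA : (fun a => fderiv ℝ (fun b => m (a, b)) e) =ᶠ[𝓝 a]
      fun a => (fderiv ℝ m (a, e)).comp (ContinuousLinearMap.inr ℝ E E) := by
    filter_upwards [ha] with x hx
    exact ((hx.differentiableAt (by simp)).hasFDerivAt.comp e (hasFDerivAt_prodMk_right x e)).fderiv
  refine ContinuousAt.congr ?_ hA.symm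
  have h1 : ContinuousAt (fderiv ℝ m) (a, e) :=
    (ha.self_of_nhds.fderiv_right (m := 1) (by norm_num)).continuousAt
  have h2 : ContinuousAt (fun a : E => (a, e)) a := by fun_prop
  exact (ContinuousAt.comp (f := fun a : E => (a, e)) h1 h2).clm_comp continuousAt_const

end Calculus

section Adjoint

local notation "φ" => extChartAt 𝓘(ℝ, E) (1 : G)

/-- The multiplication read in the chart at the identity. -/
noncomputable def chartMul (E G : Type*) [NormedAddCommGroup E] [NormedSpace ℝ E]
    [TopologicalSpace G] [ChartedSpace E G] [Group G] (p : E × E) : E :=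
  extChartAt 𝓘(ℝ, E) (1 : G) ((extChartAt 𝓘(ℝ, E) (1 : G)).symm p.1 *
    (extChartAt 𝓘(ℝ, E) (1 : G)).symm p.2)

lemma fderiv_chartMul_one_right :
    fderiv ℝ (fun b => chartMul E G (φ 1, b)) (φ 1) = ContinuousLinearMap.id ℝ E := by
  have h : (fun b => chartMul E G (φ 1, b)) =ᶠ[𝓝 (φ 1)] id := by
    filter_upwards [extChartAt_target_mem_nhds (I := 𝓘(ℝ, E)) (1 : G)] with b hb
    simp only [chartMul]
    rw [extChartAt_to_inv, one_mul, (φ).right_inv hb]; rfl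
  rw [h.fderiv_eq, fderiv_id]

lemma fderiv_chartMul_one_left :
    fderiv ℝ (fun b => chartMul E G (b, φ 1)) (φ 1) = ContinuousLinearMap.id ℝ E := by
  have h : (fun b => chartMul E G (b, φ 1)) =ᶠ[𝓝 (φ 1)] id := by
    filter_upwards [extChartAt_target_mem_nhds (I := 𝓘(ℝ, E)) (1 : G)] with b hb
    simp only [chartMul]
    rw [extChartAt_to_inv, mul_one, (φ).right_inv hb]; rfl
  rw [h.fderiv_eq, fderiv_id]

/-- A differentiable map sending `1` to `1` composes with maps sending `a` to `1`. -/
lemma hasMFDerivAt_comp_of_eq_one {F : Type*} [NormedAddCommGroup F] [NormedSpace ℝ F]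
    {ψ : G → G} {L : E →L[ℝ] E} {f : F → G} {a : F} {L₁ : F →L[ℝ] E}
    (hψ : HasMFDerivAt 𝓘(ℝ, E) 𝓘(ℝ, E) ψ 1 L) (h : f a = 1)
    (hf : HasMFDerivAt 𝓘(ℝ, F) 𝓘(ℝ, E) f a L₁) :
    HasMFDerivAt 𝓘(ℝ, F) 𝓘(ℝ, E) (fun x => ψ (f x)) a (L.comp L₁) := by
  rw [← h] at hψ
  exact hψ.comp a hf

variable [LieGroup 𝓘(ℝ, E) ∞ G]

/-- The adjoint representation: `Ad g` is the differential at the identity of the conjugation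
by `g`. The tangent space at the identity is identified with the model space `E`. -/
noncomputable def Ad (g : G) : E →L[ℝ] E :=
  mfderiv 𝓘(ℝ, E) 𝓘(ℝ, E) (fun x : G => g * x * g⁻¹) 1

lemma hasMFDerivAt_conj (g : G) :
    HasMFDerivAt 𝓘(ℝ, E) 𝓘(ℝ, E) (fun x : G => g * x * g⁻¹) 1 (Ad g : E →L[ℝ] E) :=
  ((mdifferentiableAt_mul_right (E := E) g⁻¹ (g * 1)).comp 1
    (mdifferentiableAt_mul_left g 1)).hasMFDerivAt

lemma hasMFDerivAt_mul_one_one :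
    HasMFDerivAt (𝓘(ℝ, E).prod 𝓘(ℝ, E)) 𝓘(ℝ, E) (fun p : G × G => p.1 * p.2) (1, 1)
      (ContinuousLinearMap.fst ℝ E E + ContinuousLinearMap.snd ℝ E E : E × E →L[ℝ] E) := by
  have hm : MDifferentiableAt (𝓘(ℝ, E).prod 𝓘(ℝ, E)) 𝓘(ℝ, E) (fun p : G × G => p.1 * p.2) (1, 1) :=
    (contMDiff_mul 𝓘(ℝ, E) ∞ (G := G)).mdifferentiableAt (by simp)
  refine hm.hasMFDerivAt.congr_mfderiv (ContinuousLinearMap.ext fun v => ?_)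
  refine (mfderiv_prod_eq_add_apply hm).trans ?_
  have h1 : HasMFDerivAt 𝓘(ℝ, E) 𝓘(ℝ, E) (fun x : G => 1 * x) 1
      (ContinuousLinearMap.id ℝ (TangentSpace 𝓘(ℝ, E) (1 : G))) := by
    have : (fun x : G => 1 * x) = id := by ext x; simp
    rw [this]
    exact hasMFDerivAt_id 1
  have h2 : HasMFDerivAt 𝓘(ℝ, E) 𝓘(ℝ, E) (fun x : G => x * 1) 1
      (ContinuousLinearMap.id ℝ (TangentSpace 𝓘(ℝ, E) (1 : G))) := by
    have : (fun x : G => x * 1) = id := by ext x; simp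
    rw [this]
    exact hasMFDerivAt_id 1
  exact congrArg₂ (fun A B : E →L[ℝ] E => A v.1 + B v.2) h2.mfderiv h1.mfderiv

lemma hasMFDerivAt_mul_of_eq_one {F : Type*} [NormedAddCommGroup F] [NormedSpace ℝ F]
    {f₁ f₂ : F → G} {a : F} {L₁ L₂ : F →L[ℝ] E} (h₁ : f₁ a = 1) (h₂ : f₂ a = 1)
    (hf₁ : HasMFDerivAt 𝓘(ℝ, F) 𝓘(ℝ, E) f₁ a L₁) (hf₂ : HasMFDerivAt 𝓘(ℝ, F) 𝓘(ℝ, E) f₂ a L₂) :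
    HasMFDerivAt 𝓘(ℝ, F) 𝓘(ℝ, E) (fun x => f₁ x * f₂ x) a (L₁ + L₂) := by
  have h : HasMFDerivAt (𝓘(ℝ, E).prod 𝓘(ℝ, E)) 𝓘(ℝ, E) (fun p : G × G => p.1 * p.2) (f₁ a, f₂ a)
      (ContinuousLinearMap.fst ℝ E E + ContinuousLinearMap.snd ℝ E E : E × E →L[ℝ] E) := by
    rw [h₁, h₂]; exact hasMFDerivAt_mul_one_one
  exact h.comp a (hf₁.prodMk hf₂)

lemma Ad_one : Ad (E := E) (1 : G) = ContinuousLinearMap.id ℝ E := by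
  have h : (fun x : G => 1 * x * 1⁻¹) = id := by ext x; simp
  have := hasMFDerivAt_conj (E := E) (1 : G)
  rw [h] at this
  exact hasMFDerivAt_unique this (hasMFDerivAt_id 1)

lemma Ad_mul (g h : G) : Ad (E := E) (g * h) = (Ad g).comp (Ad h) := by
  have h1 : HasMFDerivAt 𝓘(ℝ, E) 𝓘(ℝ, E) (fun x : G => g * x * g⁻¹) (h * 1 * h⁻¹)
      (Ad g : E →L[ℝ] E) := by
    have : h * 1 * h⁻¹ = 1 := by simp
    rw [this]; exact hasMFDerivAt_conj g
  have h2 := h1.comp 1 (hasMFDerivAt_conj (E := E) h)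
  have h3 : (fun x : G => g * x * g⁻¹) ∘ (fun x : G => h * x * h⁻¹)
      = fun x => (g * h) * x * (g * h)⁻¹ := by ext x; simp [mul_assoc]
  rw [h3] at h2
  exact hasMFDerivAt_unique (hasMFDerivAt_conj (g * h)) h2

lemma Ad_mul_apply (g h : G) (X : E) : Ad (g * h) X = Ad g (Ad h X) := by
  rw [Ad_mul]; rfl

lemma Ad_inv_Ad (g : G) (X : E) : Ad g⁻¹ (Ad g X) = X := by
  rw [← Ad_mul_apply, inv_mul_cancel, Ad_one]; rfl

lemma Ad_Ad_inv (g : G) (X : E) : Ad g (Ad g⁻¹ X) = X := by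
  rw [← Ad_mul_apply, mul_inv_cancel, Ad_one]; rfl

/-- `Ad g` as a linear automorphism. -/
noncomputable def AdEquiv (g : G) : E ≃ₗ[ℝ] E :=
  { (Ad g : E →L[ℝ] E).toLinearMap with
    invFun := Ad g⁻¹
    left_inv := Ad_inv_Ad g
    right_inv := Ad_Ad_inv g }

section Chart

lemma contMDiffAt_chart_symm :
    ContMDiffAt 𝓘(ℝ, E) 𝓘(ℝ, E) ∞ (φ).symm (φ 1) :=
  (contMDiffOn_extChartAt_symm (I := 𝓘(ℝ, E)) (n := ∞) (1 : G)).contMDiffAt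
    (extChartAt_target_mem_nhds 1)

lemma contDiffAt_chartMul : ContDiffAt ℝ 2 (chartMul E G) (φ 1, φ 1) := by
  have h1 : ContMDiffAt 𝓘(ℝ, E × E) 𝓘(ℝ, E) ∞ (fun p : E × E => (φ).symm p.1) (φ 1, φ 1) :=
    ContMDiffAt.comp (x := (φ 1, φ 1)) (g := (φ).symm) (f := Prod.fst) contMDiffAt_chart_symm
      contDiff_fst.contMDiff.contMDiffAt
  have h2 : ContMDiffAt 𝓘(ℝ, E × E) 𝓘(ℝ, E) ∞ (fun p : E × E => (φ).symm p.2) (φ 1, φ 1) :=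
    ContMDiffAt.comp (x := (φ 1, φ 1)) (g := (φ).symm) (f := Prod.snd) contMDiffAt_chart_symm
      contDiff_snd.contMDiff.contMDiffAt
  have h3 := h1.mul h2
  have h4 : ContMDiffAt 𝓘(ℝ, E) 𝓘(ℝ, E) ∞ φ ((φ).symm (φ 1) * (φ).symm (φ 1)) := by
    rw [extChartAt_to_inv, mul_one]
    exact contMDiffAt_extChartAt
  have h5 := ContMDiffAt.comp (x := (φ 1, φ 1)) (g := φ)
    (f := fun p : E × E => (φ).symm p.1 * (φ).symm p.2) h4 h3
  exact (contMDiffAt_iff_contDiffAt.1 h5).of_le ENat.LEInfty.out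

lemma hasMFDerivAt_chart_symm :
    HasMFDerivAt 𝓘(ℝ, E) 𝓘(ℝ, E) (φ).symm (φ 1) (ContinuousLinearMap.id ℝ E) := by
  have h : MDifferentiableAt 𝓘(ℝ, E) 𝓘(ℝ, E) (φ).symm (φ 1) :=
    contMDiffAt_chart_symm.mdifferentiableAt (by simp)
  refine h.hasMFDerivAt.congr_mfderiv ?_
  have h1 := mfderivWithin_range_extChartAt_symm (I := 𝓘(ℝ, E)) (x := (1 : G))
  rw [ModelWithCorners.range_eq_univ, mfderivWithin_univ] at h1
  exact h1

/-- Chain rule for a self-map of the group that starts at the identity, read in the chart. -/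
lemma hasFDerivAt_chart_comp {ψ : G → G} {L : E →L[ℝ] E}
    (hψ : HasMFDerivAt 𝓘(ℝ, E) 𝓘(ℝ, E) ψ 1 L) (h1 : ψ 1 ∈ (φ).source) :
    HasFDerivAt (fun b => φ (ψ ((φ).symm b)))
      ((mfderiv 𝓘(ℝ, E) 𝓘(ℝ, E) φ (ψ 1) : E →L[ℝ] E).comp L) (φ 1) := by
  have hφ := (mdifferentiableAt_extChartAt (I := 𝓘(ℝ, E)) (x := (1 : G)) (y := ψ 1)
    (by rwa [extChartAt_source] at h1)).hasMFDerivAt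
  have h2 := HasMFDerivAt.comp (1 : G) hφ hψ
  have h3 : HasMFDerivAt 𝓘(ℝ, E) 𝓘(ℝ, E) (φ ∘ ψ) ((φ).symm (φ 1))
      ((mfderiv 𝓘(ℝ, E) 𝓘(ℝ, E) φ (ψ 1) : E →L[ℝ] E).comp L) := by
    rw [extChartAt_to_inv]; exact h2
  exact hasMFDerivAt_iff_hasFDerivAt.1 (h3.comp (φ 1) hasMFDerivAt_chart_symm)

lemma fderiv_chartMul_right {a : E} (ha : a ∈ (φ).target) :
    fderiv ℝ (fun b => chartMul E G (a, b)) (φ 1) =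
      (mfderiv 𝓘(ℝ, E) 𝓘(ℝ, E) φ ((φ).symm a) : E →L[ℝ] E).comp
        (mfderiv 𝓘(ℝ, E) 𝓘(ℝ, E) (fun x : G => (φ).symm a * x) 1 : E →L[ℝ] E) := by
  have h := hasFDerivAt_chart_comp
    (mdifferentiableAt_mul_left (E := E) ((φ).symm a) 1).hasMFDerivAt
    (by rw [mul_one]; exact (φ).map_target ha)
  rw [mul_one] at h
  have h' : ∀ L : E →L[ℝ] E, HasFDerivAt (fun b => chartMul E G (a, b)) L (φ 1) →
      fderiv ℝ (fun b => chartMul E G (a, b)) (φ 1) = L := fun L hL => hL.fderiv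
  exact h' _ h

lemma fderiv_chartMul_left {a : E} (ha : a ∈ (φ).target) :
    fderiv ℝ (fun b => chartMul E G (b, a)) (φ 1) =
      (mfderiv 𝓘(ℝ, E) 𝓘(ℝ, E) φ ((φ).symm a) : E →L[ℝ] E).comp
        (mfderiv 𝓘(ℝ, E) 𝓘(ℝ, E) (fun x : G => x * (φ).symm a) 1 : E →L[ℝ] E) := by
  have h := hasFDerivAt_chart_comp
    (mdifferentiableAt_mul_right (E := E) ((φ).symm a) 1).hasMFDerivAt
    (by rw [one_mul]; exact (φ).map_target ha)
  rw [one_mul] at h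
  have h' : ∀ L : E →L[ℝ] E, HasFDerivAt (fun b => chartMul E G (b, a)) L (φ 1) →
      fderiv ℝ (fun b => chartMul E G (b, a)) (φ 1) = L := fun L hL => hL.fderiv
  exact h' _ h

lemma mfderiv_mul_right_comp_Ad (g : G) :
    (mfderiv 𝓘(ℝ, E) 𝓘(ℝ, E) (fun x : G => x * g) 1 : E →L[ℝ] E).comp
      (Ad g : E →L[ℝ] E) =
      (mfderiv 𝓘(ℝ, E) 𝓘(ℝ, E) (fun x : G => g * x) 1 : E →L[ℝ] E) := by
  have h1 : HasMFDerivAt 𝓘(ℝ, E) 𝓘(ℝ, E) (fun x : G => x * g) (g * 1 * g⁻¹)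
      (mfderiv 𝓘(ℝ, E) 𝓘(ℝ, E) (fun x : G => x * g) 1 : E →L[ℝ] E) := by
    have : g * 1 * g⁻¹ = 1 := by simp
    rw [this]; exact (mdifferentiableAt_mul_right g 1).hasMFDerivAt
  have h2 := h1.comp 1 (hasMFDerivAt_conj (E := E) g)
  have h3 : (fun x : G => x * g) ∘ (fun x : G => g * x * g⁻¹) = fun x => g * x := by
    ext x; simp
  rw [h3] at h2
  exact (h2.mfderiv).symm

lemma fderiv_chartMul_left_comp_Ad {a : E} (ha : a ∈ (φ).target) :
    (fderiv ℝ (fun b => chartMul E G (b, a)) (φ 1)).comp (Ad ((φ).symm a)) =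
      fderiv ℝ (fun b => chartMul E G (a, b)) (φ 1) := by
  rw [fderiv_chartMul_left ha, fderiv_chartMul_right ha]
  exact congrArg (fun L : E →L[ℝ] E =>
    (mfderiv 𝓘(ℝ, E) 𝓘(ℝ, E) φ ((φ).symm a) : E →L[ℝ] E).comp L) (mfderiv_mul_right_comp_Ad _)

lemma mpullbackWithin_chart_eq (X : GroupLieAlgebra 𝓘(ℝ, E) G) {a : E} (ha : a ∈ (φ).target) :
    VectorField.mpullbackWithin 𝓘(ℝ, E) 𝓘(ℝ, E) (φ).symm (mulInvariantVectorField X)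
      (range 𝓘(ℝ, E)) a = fderiv ℝ (fun b => chartMul E G (a, b)) (φ 1) X := by
  rw [fderiv_chartMul_right ha]
  have h1 := mfderiv_extChartAt_comp_mfderivWithin_extChartAt_symm (I := 𝓘(ℝ, E)) ha
  have h2 := mfderivWithin_extChartAt_symm_comp_mfderiv_extChartAt (I := 𝓘(ℝ, E)) ha
  have h3 := ContinuousLinearMap.inverse_eq h2 h1
  rw [VectorField.mpullbackWithin_apply]
  exact congrArg (fun L : E →L[ℝ] E => L (mulInvariantVectorField X ((φ).symm a))) h3

lemma bracket_eq_fderiv (X Y : GroupLieAlgebra 𝓘(ℝ, E) G)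
    {DA : E →L[ℝ] E →L[ℝ] E}
    (hA : HasFDerivAt (fun a => fderiv ℝ (fun b => chartMul E G (a, b)) (φ 1)) DA (φ 1)) :
    (⁅X, Y⁆ : GroupLieAlgebra 𝓘(ℝ, E) G) = (DA X Y - DA Y X : E) := by
  let V : E → E → E := fun Z => VectorField.mpullbackWithin 𝓘(ℝ, E) 𝓘(ℝ, E) (φ).symm
      (mulInvariantVectorField (I := 𝓘(ℝ, E)) (G := G) Z) (range 𝓘(ℝ, E))
  have key : ∀ Z : E, HasFDerivAt (V Z) (DA.flip Z) (φ 1) := by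
    intro Z
    have h1 : HasFDerivAt (fun a => fderiv ℝ (fun b => chartMul E G (a, b)) (φ 1) Z)
        (DA.flip Z) (φ 1) := by
      have := hA.clm_apply (hasFDerivAt_const Z (φ 1))
      simpa using this
    refine h1.congr_of_eventuallyEq ?_
    filter_upwards [extChartAt_target_mem_nhds (I := 𝓘(ℝ, E)) (1 : G)] with a ha
    exact mpullbackWithin_chart_eq Z ha
  have hval : ∀ Z : E, V Z (φ 1) = Z := by
    intro Z
    refine (mpullbackWithin_chart_eq Z (mem_extChartAt_target (I := 𝓘(ℝ, E)) (1 : G))).trans ?_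
    rw [fderiv_chartMul_one_right]; rfl
  have h1 : (mfderiv 𝓘(ℝ, E) 𝓘(ℝ, E) φ (1 : G)).inverse = ContinuousLinearMap.id ℝ E := by
    rw [mfderiv_extChartAt_self]
    exact ContinuousLinearMap.inverse_id
  rw [GroupLieAlgebra.bracket_def, ← VectorField.mlieBracketWithin_univ,
    VectorField.mlieBracketWithin_apply]
  refine (congrArg (fun L : E →L[ℝ] E => L _) h1).trans ?_
  have h2 : ((φ).symm ⁻¹' univ ∩ range 𝓘(ℝ, E) : Set E) = univ := by simp
  rw [h2]
  change VectorField.lieBracketWithin ℝ (V X) (V Y) univ (φ 1) = _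
  rw [VectorField.lieBracketWithin_univ]
  change fderiv ℝ (V Y) (φ 1) (V X (φ 1)) - fderiv ℝ (V X) (φ 1) (V Y (φ 1)) = _
  rw [(key Y).fderiv, (key X).fderiv, hval X, hval Y]
  rfl

end Chart

section exp

variable [CompleteSpace E] [T2Space G]

lemma Ad_expCurve_self (X : GroupLieAlgebra 𝓘(ℝ, E) G) (t : ℝ) :
    (Ad (expCurve X t) : E →L[ℝ] E) X = X := by
  have h := hasMFDerivAt_comp_of_eq_one (hasMFDerivAt_conj (E := E) (expCurve X t))
    (expCurve_zero X) (hasMFDerivAt_expCurve_zero X)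
  have h1 : (fun s => expCurve X t * expCurve X s * (expCurve X t)⁻¹) = expCurve X := by
    ext s
    rw [← expCurve_add, ← expCurve_neg, ← expCurve_add]
    simp
  rw [h1] at h
  have h2 := hasMFDerivAt_unique h (hasMFDerivAt_expCurve_zero X)
  have h3 := congrArg (fun L : ℝ →L[ℝ] E => L 1) h2
  have h4 : ((1 : ℝ →L[ℝ] ℝ).smulRight (X : E)) 1 = X := one_smul ℝ (X : E)
  exact (congrArg (Ad (expCurve X t) : E →L[ℝ] E) h4).symm.trans (h3.trans h4)

/-- The differential of the adjoint representation is the Lie bracket. In the chart at the identity,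
`Ad g` is the quotient of the differentials of the left and of the right translation by `g`. -/
lemma hasDerivAt_Ad_expCurve (X Y : GroupLieAlgebra 𝓘(ℝ, E) G) :
    HasDerivAt (fun t => (Ad (expCurve X t) : E →L[ℝ] E) Y)
      (⁅X, Y⁆ : GroupLieAlgebra 𝓘(ℝ, E) G) 0 := by
  obtain ⟨DA, DR, hA, hR, hsymm⟩ :=
    exists_hasFDerivAt_partial (contDiffAt_chartMul (E := E) (G := G))
  have hc : HasDerivAt (fun t => extChartAt 𝓘(ℝ, E) (1 : G) (expCurve X t)) (X : E) 0 := by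
    have h1 : HasMFDerivAt 𝓘(ℝ, E) 𝓘(ℝ, E) (extChartAt 𝓘(ℝ, E) (1 : G)) (expCurve X 0)
        (ContinuousLinearMap.id ℝ E) := by
      rw [expCurve_zero]
      exact (mdifferentiableAt_extChartAt (mem_chart_source E (1 : G))).hasMFDerivAt.congr_mfderiv
        mfderiv_extChartAt_self
    have h2 : HasFDerivAt (fun t => extChartAt 𝓘(ℝ, E) (1 : G) (expCurve X t))
        ((ContinuousLinearMap.id ℝ E).comp ((1 : ℝ →L[ℝ] ℝ).smulRight (X : E))) 0 :=
      hasMFDerivAt_iff_hasFDerivAt.1 (h1.comp 0 (hasMFDerivAt_expCurve_zero X))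
    refine (hasFDerivAt_iff_hasDerivAt.1 h2).congr_deriv ?_
    exact one_smul ℝ (X : E)
  set c : ℝ → E := fun t => extChartAt 𝓘(ℝ, E) (1 : G) (expCurve X t) with hcdef
  have hc0 : c 0 = extChartAt 𝓘(ℝ, E) (1 : G) 1 := by simp [hcdef]
  set A : E → E →L[ℝ] E := fun a =>
    fderiv ℝ (fun b => chartMul E G (a, b)) (extChartAt 𝓘(ℝ, E) (1 : G) 1)
  set R : E → E →L[ℝ] E := fun a =>
    fderiv ℝ (fun b => chartMul E G (b, a)) (extChartAt 𝓘(ℝ, E) (1 : G) 1)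
  have hA' : HasDerivAt (fun t => A (c t)) (DA X) 0 := by
    rw [← hc0] at hA; exact hA.comp_hasDerivAt 0 hc
  have hR' : HasDerivAt (fun t => R (c t)) (DR X) 0 := by
    rw [← hc0] at hR; exact hR.comp_hasDerivAt 0 hc
  have hR0 : R (c 0) = 1 := by rw [hc0]; exact fderiv_chartMul_one_left
  have hA0 : A (c 0) = 1 := by rw [hc0]; exact fderiv_chartMul_one_right
  have hinv : HasDerivAt (fun t => Ring.inverse (R (c t))) (-(DR X)) 0 := by
    have h1 := hasFDerivAt_ringInverse (𝕜 := ℝ) (1 : (E →L[ℝ] E)ˣ)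
    rw [Units.val_one, ← hR0] at h1
    refine (h1.comp_hasDerivAt 0 hR').congr_deriv ?_
    simp
  have hprod : ∀ y : E, HasDerivAt (fun t => Ring.inverse (R (c t)) (A (c t) y))
      ((-(DR X)) (A (c 0) y) + Ring.inverse (R (c 0)) (DA X y + A (c 0) 0)) 0 := fun y =>
    hinv.clm_apply (hA'.clm_apply (hasDerivAt_const (0 : ℝ) y))
  have hval : ∀ x y : E, (-(DR x)) (A (c 0) y) + Ring.inverse (R (c 0)) (DA x y + A (c 0) 0)
      = DA x y - DA y x := by
    intro x y
    rw [hR0, hA0, Ring.inverse_one]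
    simp only [map_zero, add_zero]
    change -(DR x y) + DA x y = DA x y - DA y x
    rw [hsymm]; abel
  have hbr := (hval X Y).trans (bracket_eq_fderiv X Y hA).symm
  refine ((hprod Y).congr_deriv hbr).congr_of_eventuallyEq ?_
  have hsrc : ∀ᶠ t in 𝓝 (0 : ℝ), expCurve X t ∈ (extChartAt 𝓘(ℝ, E) (1 : G)).source :=
    (continuous_expCurve X).continuousAt.eventually (by
      rw [expCurve_zero]; exact extChartAt_source_mem_nhds (I := 𝓘(ℝ, E)) (1 : G))
  have hunit : ∀ᶠ t in 𝓝 (0 : ℝ), IsUnit (R (c t)) :=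
    hR'.continuousAt.eventually (p := IsUnit) (by
      change {L | IsUnit L} ∈ 𝓝 (R (c 0))
      rw [hR0]; exact Units.nhds (1 : (E →L[ℝ] E)ˣ))
  filter_upwards [hsrc, hunit] with t ht hu
  have h1 := fderiv_chartMul_left_comp_Ad ((extChartAt 𝓘(ℝ, E) (1 : G)).map_source ht)
  rw [(extChartAt 𝓘(ℝ, E) (1 : G)).left_inv ht] at h1
  have h2 : A (c t) = R (c t) * (Ad (expCurve X t) : E →L[ℝ] E) := h1.symm
  rw [h2]
  change _ = (Ring.inverse (R (c t)) * (R (c t) * (Ad (expCurve X t) : E →L[ℝ] E))) Y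
  rw [← mul_assoc, Ring.inverse_mul_cancel _ hu, one_mul]

end exp

end Adjoint

/-! ### The semigroup generated by a horizontal half-space has interior points -/

section HalfSpace

variable {V : ℕ → Submodule ℝ (GroupLieAlgebra 𝓘(ℝ, E) G)}
  {W : Set (GroupLieAlgebra 𝓘(ℝ, E) G)}

lemma IsHorizontalHalfSpace.mem_layer (hW : IsHorizontalHalfSpace V W)
    {X : GroupLieAlgebra 𝓘(ℝ, E) G} (hX : X ∈ W) : X ∈ V 1 := by
  obtain ⟨ξ, -, rfl⟩ := hW
  exact hX.1

lemma IsHorizontalHalfSpace.zero_mem (hW : IsHorizontalHalfSpace V W) :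
    (0 : GroupLieAlgebra 𝓘(ℝ, E) G) ∈ W := by
  obtain ⟨ξ, -, rfl⟩ := hW
  exact ⟨(V 1).zero_mem, (map_zero ξ).ge⟩

lemma IsHorizontalHalfSpace.smul_mem (hW : IsHorizontalHalfSpace V W)
    {X : GroupLieAlgebra 𝓘(ℝ, E) G} (hX : X ∈ W) {t : ℝ} (ht : 0 ≤ t) : t • X ∈ W := by
  obtain ⟨ξ, -, rfl⟩ := hW
  obtain ⟨h, hX⟩ := hX
  refine ⟨(V 1).smul_mem t h, ?_⟩
  have : (⟨t • X, (V 1).smul_mem t h⟩ : V 1) = t • ⟨X, h⟩ := rfl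
  rw [this, map_smul]
  exact mul_nonneg ht hX

lemma IsHorizontalHalfSpace.mem_or_neg_mem (hW : IsHorizontalHalfSpace V W)
    {X : GroupLieAlgebra 𝓘(ℝ, E) G} (hX : X ∈ V 1) : X ∈ W ∨ -X ∈ W := by
  obtain ⟨ξ, -, rfl⟩ := hW
  rcases le_total 0 (ξ ⟨X, hX⟩) with h | h
  · exact Or.inl ⟨hX, h⟩
  · refine Or.inr ⟨(V 1).neg_mem hX, ?_⟩
    have : (⟨-X, (V 1).neg_mem hX⟩ : V 1) = -⟨X, hX⟩ := rfl
    rw [this, map_neg]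
    linarith

variable [LieGroup 𝓘(ℝ, E) ∞ G] [CompleteSpace E] [T2Space G]

lemma IsHorizontalHalfSpace.expCurve_mem (hW : IsHorizontalHalfSpace V W)
    {X : GroupLieAlgebra 𝓘(ℝ, E) G} (hX : X ∈ W) {t : ℝ} (ht : 0 ≤ t) :
    expCurve X t ∈ semigroupGen W := by
  refine Subsemigroup.subset_closure ?_
  rw [expSet_eq]
  exact ⟨t • X, hW.smul_mem hX ht, by simpa using expCurve_smul X t 1⟩

lemma IsHorizontalHalfSpace.one_mem (hW : IsHorizontalHalfSpace V W) :
    (1 : G) ∈ semigroupGen W := by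
  simpa using hW.expCurve_mem hW.zero_mem le_rfl

end HalfSpace

section Reachable

/-- `D` is the left-trivialized image of the differential, at an interior point of the parameter
space, of a `C¹` family of points of `S` on which `ℓ` is bounded. -/
def IsReachable (S : Set G) (ℓ : G → ℝ≥0∞) (D : Submodule ℝ E) : Prop :=
  ∃ (F : Type) (_ : NormedAddCommGroup F) (_ : NormedSpace ℝ F) (_ : CompleteSpace F)
    (f : F → G) (L : F →L[ℝ] E), f 0 = 1 ∧ ContMDiffAt 𝓘(ℝ, F) 𝓘(ℝ, E) 1 f 0 ∧
      HasMFDerivAt 𝓘(ℝ, F) 𝓘(ℝ, E) f 0 L ∧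
      (∃ (g : G) (R : ℝ≥0∞), R ≠ ⊤ ∧ ∀ᶠ x in 𝓝 0, g * f x ∈ S ∧ ℓ (g * f x) ≤ R) ∧
      LinearMap.range L.toLinearMap = D

lemma isReachable_bot {S : Set G} {ℓ : G → ℝ≥0∞} (h1 : (1 : G) ∈ S) (hℓ : ℓ 1 ≠ ⊤) :
    IsReachable S ℓ (⊥ : Submodule ℝ E) := by
  refine ⟨ℝ, inferInstance, inferInstance, inferInstance, fun _ => 1, 0, rfl, contMDiffAt_const,
    hasMFDerivAt_const 1 0, ⟨1, ℓ 1, hℓ, by simp [h1]⟩, ?_⟩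
  exact LinearMap.range_zero

variable [LieGroup 𝓘(ℝ, E) ∞ G]

local notation "φ" => extChartAt 𝓘(ℝ, E) (1 : G)

/-- A `C¹` map into the group that is a submersion at a point sent to `1` is open at this point. -/
lemma image_mem_nhds_one_of_surjective {F : Type*} [NormedAddCommGroup F] [NormedSpace ℝ F]
    [CompleteSpace E] [CompleteSpace F] {f : F → G} {L : F →L[ℝ] E} {a : F} (h1 : f a = 1)
    (hf : ContMDiffAt 𝓘(ℝ, F) 𝓘(ℝ, E) 1 f a) (hL : HasMFDerivAt 𝓘(ℝ, F) 𝓘(ℝ, E) f a L)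
    (hsurj : LinearMap.range L.toLinearMap = ⊤) {N : Set F} (hN : N ∈ 𝓝 a) :
    f '' N ∈ 𝓝 (1 : G) := by
  have hc : ContDiffAt ℝ 1 (fun x => φ (f x)) a := by
    have := (contMDiffAt_iff_target.1 hf).2
    rw [h1, contMDiffAt_iff_contDiffAt] at this
    exact this
  have hφ : HasMFDerivAt 𝓘(ℝ, E) 𝓘(ℝ, E) φ (f a) (ContinuousLinearMap.id ℝ E) := by
    rw [h1]
    exact (mdifferentiableAt_extChartAt (mem_chart_source E (1 : G))).hasMFDerivAt.congr_mfderiv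
      mfderiv_extChartAt_self
  have hL' : HasFDerivAt (fun x => φ (f x)) L a := by
    have h2 := hasMFDerivAt_iff_hasFDerivAt.1 (hφ.comp a hL)
    exact h2
  have hs := hc.hasStrictFDerivAt' hL' (by simp)
  have hmap := hs.map_nhds_eq_of_surj hsurj
  have hN' : N ∩ f ⁻¹' (φ).source ∈ 𝓝 a :=
    inter_mem hN (hf.continuousAt.preimage_mem_nhds (by
      rw [h1]; exact extChartAt_source_mem_nhds (I := 𝓘(ℝ, E)) (1 : G)))
  have h2 : (fun x => φ (f x)) '' (N ∩ f ⁻¹' (φ).source) ∈ 𝓝 (φ 1) := by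
    have h4 := image_mem_map (m := fun x => φ (f x)) hN'
    rw [hmap, h1] at h4
    exact h4
  have h3 : φ ⁻¹' ((fun x => φ (f x)) '' (N ∩ f ⁻¹' (φ).source)) ∈ 𝓝 (1 : G) :=
    (continuousAt_extChartAt (I := 𝓘(ℝ, E)) (1 : G)).preimage_mem_nhds h2
  filter_upwards [h3, extChartAt_source_mem_nhds (I := 𝓘(ℝ, E)) (1 : G)] with g hg hg'
  obtain ⟨x, ⟨hxN, hx⟩, hxg⟩ := hg
  exact ⟨x, hxN, (φ).injOn hx hg' hxg⟩

section exp

variable [CompleteSpace E] [T2Space G]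

lemma hasDerivAt_chart_expCurve (X : GroupLieAlgebra 𝓘(ℝ, E) G) {t : ℝ}
    (ht : expCurve X t ∈ (φ).source) :
    HasDerivAt (fun s => φ (expCurve X s))
      (fderiv ℝ (fun b => chartMul E G (φ (expCurve X t), b)) (φ 1) X) t := by
  have hg := (mdifferentiableAt_mul_left (E := E) (expCurve X t) 1).hasMFDerivAt
  have h1 : HasMFDerivAt 𝓘(ℝ, E) 𝓘(ℝ, E) φ (expCurve X t)
      (mfderiv 𝓘(ℝ, E) 𝓘(ℝ, E) φ (expCurve X t) : E →L[ℝ] E) :=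
    (mdifferentiableAt_extChartAt (by rwa [extChartAt_source] at ht)).hasMFDerivAt
  have h2 : HasFDerivAt (fun s => φ (expCurve X s))
      ((mfderiv 𝓘(ℝ, E) 𝓘(ℝ, E) φ (expCurve X t) : E →L[ℝ] E).comp
        ((1 : ℝ →L[ℝ] ℝ).smulRight (mulInvariantVectorField X (expCurve X t) : E))) t :=
    hasMFDerivAt_iff_hasFDerivAt.1 (h1.comp t (isMIntegralCurve_expCurve X t))
  have h3 : ∀ L : ℝ →L[ℝ] E, HasFDerivAt (fun s => φ (expCurve X s)) L t →
      HasDerivAt (fun s => φ (expCurve X s)) (L 1) t := fun L hL => hL.hasDerivAt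
  refine (h3 _ h2).congr_deriv ?_
  rw [fderiv_chartMul_right ((φ).map_source ht), (φ).left_inv ht]
  exact congrArg (mfderiv 𝓘(ℝ, E) 𝓘(ℝ, E) φ (expCurve X t) : E →L[ℝ] E)
    (one_smul ℝ (mulInvariantVectorField X (expCurve X t) : E))

lemma contMDiffAt_expCurve_zero (X : GroupLieAlgebra 𝓘(ℝ, E) G) :
    ContMDiffAt 𝓘(ℝ, ℝ) 𝓘(ℝ, E) 1 (expCurve X) 0 := by
  rw [contMDiffAt_iff_target]
  refine ⟨(continuous_expCurve X).continuousAt, ?_⟩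
  rw [expCurve_zero, contMDiffAt_iff_contDiffAt]
  have hcont : ContinuousAt (fun s => φ (expCurve X s)) 0 :=
    ContinuousAt.comp (g := φ) (by rw [expCurve_zero]; exact continuousAt_extChartAt 1)
      (continuous_expCurve X).continuousAt
  have hsrc : ∀ᶠ t in 𝓝 (0 : ℝ), expCurve X t ∈ (φ).source :=
    (continuous_expCurve X).continuousAt.eventually (by
      rw [expCurve_zero]; exact extChartAt_source_mem_nhds (I := 𝓘(ℝ, E)) (1 : G))
  have hA : ∀ᶠ t in 𝓝 (0 : ℝ), ContinuousAt
      (fun a => fderiv ℝ (fun b => chartMul E G (a, b)) (φ 1)) (φ (expCurve X t)) :=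
    hcont.eventually (by
      beta_reduce
      rw [expCurve_zero]
      exact eventually_continuousAt_partial (contDiffAt_chartMul (E := E) (G := G)))
  rw [contDiffAt_one_iff]
  refine ⟨fun t => (1 : ℝ →L[ℝ] ℝ).smulRight
    (fderiv ℝ (fun b => chartMul E G (φ (expCurve X t), b)) (φ 1) X), _,
    hsrc.and hA, ?_, fun t ht => hasDerivAt_iff_hasFDerivAt.1 ?_⟩
  · rintro t ⟨ht, ht'⟩
    have h1 : ContinuousAt (fun s => φ (expCurve X s)) t :=
      ContinuousAt.comp (g := φ)
        (continuousAt_extChartAt' (by rwa [extChartAt_source] at ht ⊢))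
        (continuous_expCurve X).continuousAt
    have h2 := (ContinuousAt.comp (f := fun s => φ (expCurve X s)) ht' h1).clm_apply
      (continuousAt_const (y := (X : E)))
    exact (((ContinuousLinearMap.smulRightL ℝ ℝ E (1 : ℝ →L[ℝ] ℝ)).continuous.continuousAt).comp
      h2).continuousWithinAt
  · exact hasDerivAt_chart_expCurve X ht.1

/-- Following a family `f` of points of the semigroup by the flow of `X ∈ W`, for times near `1`,
gives a new family. Normalized to take the value `1` at the origin, it is
`(x, t) ↦ h⁻¹ * f x * h * expCurve X t` with `h = expCurve X 1`. -/
lemma IsReachable.step {V : ℕ → Submodule ℝ (GroupLieAlgebra 𝓘(ℝ, E) G)}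
    {W : Set (GroupLieAlgebra 𝓘(ℝ, E) G)} (hW : IsHorizontalHalfSpace V W)
    {ℓ : G → ℝ≥0∞} (hmul : ∀ g h, ℓ (g * h) ≤ ℓ g + ℓ h)
    {X : GroupLieAlgebra 𝓘(ℝ, E) G} {x : E} (hx : x = X) (hX : X ∈ W)
    (hexp : ∃ R : ℝ≥0∞, R ≠ ⊤ ∧ ∀ t ∈ Icc (0 : ℝ) 2, ℓ (expCurve X t) ≤ R)
    {D : Submodule ℝ E} (hD : IsReachable (semigroupGen W : Set G) ℓ D) :
    IsReachable (semigroupGen W : Set G) ℓ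
      (D.map (AdEquiv (E := E) (expCurve X 1)⁻¹).toLinearMap ⊔ Submodule.span ℝ {x}) := by
  obtain ⟨F, i1, i2, i3, f, L, hf1, hf, hL, ⟨g, R, hR, hgR⟩, rfl⟩ := hD
  obtain ⟨R', hR', hexp⟩ := hexp
  set h := expCurve X 1 with hh
  have : LieGroup 𝓘(ℝ, E) 1 G := LieGroup.of_le (n := ∞) (mod_cast le_top)
  have hexp' : HasMFDerivAt 𝓘(ℝ, ℝ) 𝓘(ℝ, E) (expCurve X) 0 ((1 : ℝ →L[ℝ] ℝ).smulRight x) := by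
    rw [hx]; exact hasMFDerivAt_expCurve_zero X
  have hconj : h⁻¹ * f 0 * h⁻¹⁻¹ = 1 := by simp [hf1]
  refine ⟨F × ℝ, inferInstance, inferInstance, inferInstance,
    fun p => h⁻¹ * f p.1 * h⁻¹⁻¹ * expCurve X p.2,
    ((Ad h⁻¹ : E →L[ℝ] E).comp L).comp (ContinuousLinearMap.fst ℝ F ℝ) +
      ((1 : ℝ →L[ℝ] ℝ).smulRight x).comp (ContinuousLinearMap.snd ℝ F ℝ),
    by simp [hf1], ?_, ?_, ⟨g * h, R + R', by simp [hR, hR'], ?_⟩, ?_⟩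
  · have h1 : ContMDiffAt 𝓘(ℝ, F × ℝ) 𝓘(ℝ, E) 1 (fun p : F × ℝ => f p.1) 0 :=
      ContMDiffAt.comp (x := (0 : F × ℝ)) (I' := 𝓘(ℝ, F)) (g := f) (f := Prod.fst) hf
        contDiff_fst.contMDiff.contMDiffAt
    have h2 : ContMDiffAt 𝓘(ℝ, F × ℝ) 𝓘(ℝ, E) 1 (fun p : F × ℝ => expCurve X p.2) 0 :=
      ContMDiffAt.comp (x := (0 : F × ℝ)) (I' := 𝓘(ℝ, ℝ)) (g := expCurve X) (f := Prod.snd)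
        (contMDiffAt_expCurve_zero X) contDiff_snd.contMDiff.contMDiffAt
    exact ((contMDiffAt_const.mul h1).mul contMDiffAt_const).mul h2
  · refine hasMFDerivAt_mul_of_eq_one (f₁ := fun p : F × ℝ => h⁻¹ * f p.1 * h⁻¹⁻¹)
      (f₂ := fun p : F × ℝ => expCurve X p.2) (a := (0 : F × ℝ)) hconj (expCurve_zero X) ?_ ?_
    · refine HasMFDerivAt.comp (I' := 𝓘(ℝ, F)) (0 : F × ℝ) (f := Prod.fst)
        (g := fun x => h⁻¹ * f x * h⁻¹⁻¹)
        (hasMFDerivAt_comp_of_eq_one (hasMFDerivAt_conj (E := E) h⁻¹) hf1 hL)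
        (hasFDerivAt_fst.hasMFDerivAt)
    · exact HasMFDerivAt.comp (I' := 𝓘(ℝ, ℝ)) (0 : F × ℝ) (f := Prod.snd)
        (g := expCurve X) hexp' (hasFDerivAt_snd.hasMFDerivAt)
  · have h1 : ∀ᶠ p : F × ℝ in 𝓝 0, g * f p.1 ∈ (semigroupGen W : Set G) ∧ ℓ (g * f p.1) ≤ R :=
      (continuous_fst.tendsto' (0 : F × ℝ) 0 rfl).eventually hgR
    have h2 : ∀ᶠ p : F × ℝ in 𝓝 0, p.2 ∈ Ioo (-1 : ℝ) 1 :=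
      (continuous_snd.tendsto' (0 : F × ℝ) 0 rfl).eventually (Ioo_mem_nhds (by simp) (by simp))
    filter_upwards [h1, h2] with p hp1 hp2
    have h3 : g * h * (h⁻¹ * f p.1 * h⁻¹⁻¹ * expCurve X p.2)
        = g * f p.1 * expCurve X (1 + p.2) := by
      rw [expCurve_add, ← hh]; group
    rw [h3]
    exact ⟨(semigroupGen W).mul_mem hp1.1 (hW.expCurve_mem hX (by linarith [hp2.1])),
      (hmul _ _).trans (add_le_add hp1.2 (hexp _ ⟨by linarith [hp2.1], by linarith [hp2.2]⟩))⟩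
  · refine le_antisymm ?_ (sup_le ?_ ?_)
    · rintro _ ⟨⟨u, t⟩, rfl⟩
      exact Submodule.add_mem_sup ⟨L u, ⟨u, rfl⟩, rfl⟩
        (Submodule.smul_mem _ t (Submodule.mem_span_singleton_self x))
    · rintro _ ⟨_, ⟨u, rfl⟩, rfl⟩
      refine ⟨(u, 0), ?_⟩
      change Ad h⁻¹ (L u) + (0 : ℝ) • x = Ad h⁻¹ (L u)
      simp
    · rw [Submodule.span_singleton_le_iff_mem]
      refine ⟨(0, 1), ?_⟩
      change (Ad h⁻¹ : E →L[ℝ] E) (L 0) + (1 : ℝ) • x = x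
      simp

variable [FiniteDimensional ℝ E]

/-- A reachable subspace of maximal dimension is the whole Lie algebra. By maximality,
`IsReachable.step` does not increase its dimension; this forces it to contain `Ad h X` for all
`X ∈ W` and all `h` in the semigroup, hence, differentiating along flows, all iterated brackets of
elements of the first layer. -/
lemma isReachable_top {V : ℕ → Submodule ℝ (GroupLieAlgebra 𝓘(ℝ, E) G)}
    (hV : IsStratification V) {W : Set (GroupLieAlgebra 𝓘(ℝ, E) G)}
    (hW : IsHorizontalHalfSpace V W)
    {ℓ : G → ℝ≥0∞} (hmul : ∀ g h, ℓ (g * h) ≤ ℓ g + ℓ h) (h1 : ℓ 1 ≠ ⊤)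
    (hexp : ∀ X ∈ W, ∃ R : ℝ≥0∞, R ≠ ⊤ ∧ ∀ t ∈ Icc (0 : ℝ) 2, ℓ (expCurve X t) ≤ R) :
    IsReachable (semigroupGen W : Set G) ℓ (⊤ : Submodule ℝ E) := by
  set P : Submodule ℝ E → Prop := IsReachable (semigroupGen W : Set G) ℓ with hP
  set N : Set ℕ := {n | ∃ D, P D ∧ Module.finrank ℝ D = n} with hN
  have hNne : N.Nonempty := ⟨_, ⊥, isReachable_bot hW.one_mem h1, rfl⟩
  have hNbdd : BddAbove N := ⟨Module.finrank ℝ E, by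
    rintro _ ⟨D, -, rfl⟩; exact Submodule.finrank_le D⟩
  obtain ⟨D, hD, hDn⟩ := Nat.sSup_mem hNne hNbdd
  -- the properties of reachable subspaces of maximal dimension
  have hstep : ∀ D : Submodule ℝ E, P D → Module.finrank ℝ D = sSup N → ∀ X ∈ W, ∀ x : E, x = X →
      x ∈ D ∧ P (D.map (AdEquiv (E := E) (expCurve X 1)⁻¹).toLinearMap) := by
    intro D hD hDn X hX x hx
    have h2 := hD.step hW hmul hx hX (hexp X hX)
    have h3 :
        Module.finrank ℝ (D.map (AdEquiv (E := E) (expCurve X 1)⁻¹).toLinearMap) = sSup N := by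
      rw [← hDn]; exact LinearEquiv.finrank_map_eq _ _
    have h4 := Submodule.eq_of_le_of_finrank_le (le_sup_left (a := D.map (AdEquiv (E := E)
      (expCurve X 1)⁻¹).toLinearMap) (b := Submodule.span ℝ {x}))
      ((le_csSup hNbdd ⟨_, h2, rfl⟩).trans h3.ge)
    rw [← h4] at h2
    refine ⟨?_, h2⟩
    have h5 : x ∈ D.map (AdEquiv (E := E) (expCurve X 1)⁻¹).toLinearMap := by
      rw [h4]; exact Submodule.mem_sup_right (Submodule.mem_span_singleton_self _)
    obtain ⟨Y, hY, hYX⟩ := h5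
    have h6 : Ad (expCurve X 1)⁻¹ Y = x := hYX
    have h7 : Y = x := by
      have := Ad_Ad_inv (expCurve X 1) Y
      rw [h6, hx] at this
      exact this.symm.trans ((Ad_expCurve_self X 1).trans hx.symm)
    rw [← h7]; exact hY
  have hinv : ∀ h ∈ semigroupGen W, ∀ D : Submodule ℝ E, P D → Module.finrank ℝ D = sSup N →
      P (D.map (AdEquiv (E := E) h⁻¹).toLinearMap) := by
    intro h hh
    induction hh using Subsemigroup.closure_induction with
    | mem g hg =>
      rw [expSet_eq] at hg
      obtain ⟨X, hX, rfl⟩ := hg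
      exact fun D hD hDn => (hstep D hD hDn X hX X rfl).2
    | mul g h _ _ ihg ihh =>
      intro D hD hDn
      have h2 := ihh _ (ihg D hD hDn) ((LinearEquiv.finrank_map_eq _ _).trans hDn)
      have h3 : D.map (AdEquiv (E := E) (g * h)⁻¹).toLinearMap =
          (D.map (AdEquiv (E := E) g⁻¹).toLinearMap).map (AdEquiv (E := E) h⁻¹).toLinearMap := by
        rw [← Submodule.map_comp]
        congr 1
        ext Y
        change Ad (g * h)⁻¹ Y = Ad h⁻¹ (Ad g⁻¹ Y)
        rw [mul_inv_rev, Ad_mul_apply]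
      rw [h3]; exact h2
  have hAdW : ∀ h ∈ semigroupGen W, ∀ X ∈ W, (Ad h : E →L[ℝ] E) X ∈ D := by
    intro h hh X hX
    obtain ⟨Y, hY, hYX⟩ := (hstep _ (hinv h hh D hD hDn)
      ((LinearEquiv.finrank_map_eq _ _).trans hDn) X hX X rfl).1
    have h2 : Ad h⁻¹ Y = (X : E) := hYX
    have h3 : (Ad h : E →L[ℝ] E) X = Y := by rw [← h2]; exact Ad_Ad_inv h Y
    rw [h3]; exact hY
  have hclosed : IsClosed (D : Set E) := D.closed_of_finiteDimensional
  have hAdV : ∀ j : ℕ, ∀ Y ∈ V (j + 1), ∀ h ∈ semigroupGen W, (Ad h : E →L[ℝ] E) Y ∈ D := by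
    intro j
    induction j with
    | zero =>
      intro Y hY h hh
      rcases hW.mem_or_neg_mem hY with h2 | h2
      · exact hAdW h hh Y h2
      · have h3 := D.neg_mem (hAdW h hh _ h2)
        have h4 : ∀ Z : E, -((Ad h : E →L[ℝ] E) (-Z)) = Ad h Z := fun Z => by
          rw [map_neg, neg_neg]
        exact (h4 Y) ▸ h3
    | succ j ih =>
      have hbr : ∀ X ∈ W, ∀ Y ∈ V (j + 1), ∀ h ∈ semigroupGen W,
          (Ad h : E →L[ℝ] E) (⁅X, Y⁆ : GroupLieAlgebra 𝓘(ℝ, E) G) ∈ D := by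
        intro X hX Y hY h hh
        have hder : ∀ y Z : E, y = Y →
            HasDerivAt (fun t => (Ad (expCurve X t) : E →L[ℝ] E) y) Z 0 → Ad h Z ∈ D := by
          rintro y Z hy hZ
          have h2 := ((Ad h : E →L[ℝ] E).hasFDerivAt.comp_hasDerivAt 0 hZ).tendsto_slope_zero_right
          refine hclosed.mem_of_tendsto h2 ?_
          filter_upwards [self_mem_nhdsWithin] with t ht
          refine D.smul_mem _ (D.sub_mem ?_ ?_)
          · have h3 := ih Y hY (h * expCurve X (0 + t))
              ((semigroupGen W).mul_mem hh (hW.expCurve_mem hX (by simpa using le_of_lt ht)))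
            rw [Ad_mul] at h3
            rw [hy]; exact h3
          · have h3 := ih Y hY h hh
            simp only [Function.comp_apply, expCurve_zero, Ad_one]
            rw [hy]; exact h3
        exact hder Y _ rfl (hasDerivAt_Ad_expCurve X Y)
      intro Y hY h hh
      rw [← hV.bracket (j + 1) (by omega)] at hY
      induction hY using Submodule.span_induction with
      | mem Z hZ =>
        obtain ⟨X, hX, Y, hY, rfl⟩ := hZ
        rcases hW.mem_or_neg_mem hX with h2 | h2
        · exact hbr X h2 Y hY h hh
        · have h3 := D.neg_mem (hbr _ h2 Y hY h hh)
          rw [neg_lie] at h3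
          have h4 : ∀ Z : E, -((Ad h : E →L[ℝ] E) (-Z)) = Ad h Z := fun Z => by
            rw [map_neg, neg_neg]
          exact (h4 (⁅X, Y⁆ : GroupLieAlgebra 𝓘(ℝ, E) G)) ▸ h3
      | zero => exact (map_zero (Ad h : E →L[ℝ] E)).symm ▸ D.zero_mem
      | add Y Z _ _ ihY ihZ => exact (map_add (Ad h : E →L[ℝ] E) Y Z).symm ▸ D.add_mem ihY ihZ
      | smul c Y _ ihY => exact (map_smul (Ad h : E →L[ℝ] E) c Y).symm ▸ D.smul_mem c ihY
  have htop : D = ⊤ := by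
    rw [eq_top_iff]
    rintro Y -
    have hY : (Y : GroupLieAlgebra 𝓘(ℝ, E) G) ∈ ⨆ j, V j := by
      rw [hV.isInternal.submodule_iSup_eq_top]; trivial
    induction hY using Submodule.iSup_induction' with
    | mem j Y hY =>
      rcases j with - | j
      · rw [hV.zero] at hY
        have h0 : Y = (0 : E) := (Submodule.mem_bot (M := GroupLieAlgebra 𝓘(ℝ, E) G) ℝ).1 hY
        rw [h0]; exact D.zero_mem
      · have := hAdV j Y hY 1 hW.one_mem
        rw [Ad_one] at this
        exact this
    | zero => exact D.zero_mem
    | add Y Z _ _ ihY ihZ => exact D.add_mem ihY ihZ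
  rw [← htop]; exact hD

/-- The points of the semigroup with bounded `ℓ` contain a nonempty open set. -/
lemma exists_nonempty_interior_semigroupGen [ContinuousMul G]
    {V : ℕ → Submodule ℝ (GroupLieAlgebra 𝓘(ℝ, E) G)}
    (hV : IsStratification V) {W : Set (GroupLieAlgebra 𝓘(ℝ, E) G)}
    (hW : IsHorizontalHalfSpace V W)
    {ℓ : G → ℝ≥0∞} (hmul : ∀ g h, ℓ (g * h) ≤ ℓ g + ℓ h) (h1 : ℓ 1 ≠ ⊤)
    (hexp : ∀ X ∈ W, ∃ R : ℝ≥0∞, R ≠ ⊤ ∧ ∀ t ∈ Icc (0 : ℝ) 2, ℓ (expCurve X t) ≤ R) :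
    ∃ R : ℝ≥0∞, R ≠ ⊤ ∧ (interior ((semigroupGen W : Set G) ∩ {g | ℓ g ≤ R})).Nonempty := by
  obtain ⟨F, i1, i2, i3, f, L, hf1, hf, hL, ⟨g, R, hR, hgR⟩, hsurj⟩ :=
    isReachable_top hV hW hmul h1 hexp
  refine ⟨R, hR, g, mem_interior_iff_mem_nhds.2 ?_⟩
  have h2 := image_mem_nhds_one_of_surjective hf1 hf hL hsurj hgR
  have h3 := (continuous_const_mul g⁻¹).continuousAt.preimage_mem_nhds (x := g)
    (by rw [inv_mul_cancel]; exact h2)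
  filter_upwards [h3] with x hx
  obtain ⟨y, hy, hyx⟩ := hx
  have h4 : g * f y = x := by rw [hyx]; group
  rw [← h4]; exact hy

end exp

end Reachable

/-! ### The Carnot distance -/

section Core

variable {F : Type*} [AddCommGroup F] [Module ℝ F] (ip : InnerProductSpace.Core ℝ F)

lemma sqrt_inner_smul (c : ℝ) (x : F) :
    Real.sqrt (ip.inner (c • x) (c • x)) = |c| * Real.sqrt (ip.inner x x) := by
  let _ := ip.toNormedAddCommGroup
  let _ := InnerProductSpace.ofCore ip.toCore
  have h1 : ∀ y : F, Real.sqrt (ip.inner y y) = ‖y‖ := fun y => rfl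
  rw [h1, h1, norm_smul, Real.norm_eq_abs]

lemma exists_norm_le_sqrt_inner [FiniteDimensional ℝ F] (L : F →ₗ[ℝ] E) :
    ∃ C : ℝ, 0 ≤ C ∧ ∀ x, ‖L x‖ ≤ C * Real.sqrt (ip.inner x x) := by
  let _ := ip.toNormedAddCommGroup
  let _ := InnerProductSpace.ofCore ip.toCore
  exact ⟨‖LinearMap.toContinuousLinearMap L‖, ContinuousLinearMap.opNorm_nonneg _,
    fun x => (LinearMap.toContinuousLinearMap L).le_opNorm x⟩

end Core

variable {V : ℕ → Submodule ℝ (GroupLieAlgebra 𝓘(ℝ, E) G)} {ip : InnerProductSpace.Core ℝ (V 1)}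

lemma carnotDist_le_of_isHorizontalCurve {γ : ℝ → G} {u : ℝ → V 1} (h : IsHorizontalCurve V γ u) :
    carnotDist V ip (γ 0) (γ 1) ≤
      ∫⁻ t in Icc (0 : ℝ) 1, ENNReal.ofReal (Real.sqrt (ip.inner (u t) (u t))) :=
  iInf₂_le_of_le γ u (iInf_le_of_le h (iInf_le_of_le rfl (iInf_le_of_le rfl le_rfl)))

lemma le_carnotDist {p q : G} {c : ℝ≥0∞}
    (h : ∀ (γ : ℝ → G) (u : ℝ → V 1), IsHorizontalCurve V γ u → γ 0 = p → γ 1 = q →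
      c ≤ ∫⁻ t in Icc (0 : ℝ) 1, ENNReal.ofReal (Real.sqrt (ip.inner (u t) (u t)))) :
    c ≤ carnotDist V ip p q :=
  le_iInf₂ fun γ u => le_iInf fun hγ => le_iInf₂ fun h0 h1 => h γ u hγ h0 h1

lemma exists_of_carnotDist_lt {p q : G} {c : ℝ≥0∞} (h : carnotDist V ip p q < c) :
    ∃ (γ : ℝ → G) (u : ℝ → V 1), IsHorizontalCurve V γ u ∧ γ 0 = p ∧ γ 1 = q ∧
      ∫⁻ t in Icc (0 : ℝ) 1, ENNReal.ofReal (Real.sqrt (ip.inner (u t) (u t))) < c := by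
  simp only [carnotDist, iInf_lt_iff] at h
  obtain ⟨γ, u, hγ, h0, h1, h⟩ := h
  exact ⟨γ, u, hγ, h0, h1, h⟩

/-- An affine change of variables, which makes the length of a curve independent of its
parametrization. -/
lemma lintegral_comp_affine (N : ℝ → ℝ≥0∞) {a b : ℝ} (ha : 0 < a) (c d : ℝ)
    (hc : a * c + b = 0) (hd : a * d + b = 1) :
    ∫⁻ t in Ioo c d, ENNReal.ofReal a * N (a * t + b) = ∫⁻ t in Icc (0 : ℝ) 1, N t := by
  have himg : (fun t => a * t + b) '' Ioo c d = Ioo 0 1 := by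
    rw [← hc, ← hd]
    ext x
    constructor
    · rintro ⟨t, ⟨h1, h2⟩, rfl⟩
      exact ⟨by simpa using mul_lt_mul_of_pos_left h1 ha,
        by simpa using mul_lt_mul_of_pos_left h2 ha⟩
    · rintro ⟨h1, h2⟩
      refine ⟨(x - b) / a, ⟨?_, ?_⟩, by field_simp; ring⟩
      · rw [lt_div_iff₀ ha]; linarith
      · rw [div_lt_iff₀ ha]; linarith
  have h := lintegral_image_eq_lintegral_abs_deriv_mul (s := Ioo c d) (f := fun t => a * t + b)
    (f' := fun _ => a) measurableSet_Ioo
    (fun x _ => by simpa using (((hasDerivAt_id x).const_mul a).add_const b).hasDerivWithinAt)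
    (fun x _ y _ h => by simpa [ha.ne'] using h) N
  rw [himg, abs_of_pos ha] at h
  rw [← h, restrict_Ioo_eq_restrict_Icc]

section Curves

/-- An affine change of time multiplies the velocity of a horizontal curve by its slope. -/
lemma hasMFDerivAt_comp_affine {γ : ℝ → G} {X : V 1} {a b t : ℝ}
    (h : HasMFDerivAt 𝓘(ℝ, ℝ) 𝓘(ℝ, E) γ (a * t + b)
      ((1 : ℝ →L[ℝ] ℝ).smulRight
        (mulInvariantVectorField (X : GroupLieAlgebra 𝓘(ℝ, E) G) (γ (a * t + b))))) :
    HasMFDerivAt 𝓘(ℝ, ℝ) 𝓘(ℝ, E) (fun s => γ (a * s + b)) t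
      ((1 : ℝ →L[ℝ] ℝ).smulRight
        (mulInvariantVectorField ((a • X : V 1) : GroupLieAlgebra 𝓘(ℝ, E) G) (γ (a * t + b)))) := by
  have h1 : HasFDerivAt (fun s : ℝ => a * s + b) ((1 : ℝ →L[ℝ] ℝ).smulRight a) t := by
    have h0 : HasDerivAt (fun s : ℝ => a * s + b) a t := by
      simpa using ((hasDerivAt_id t).const_mul a).add_const b
    exact hasDerivAt_iff_hasFDerivAt.1 h0
  refine (h.comp t h1.hasMFDerivAt).congr_mfderiv (ContinuousLinearMap.ext_ring ?_)
  have h2 : mulInvariantVectorField ((a • X : V 1) : GroupLieAlgebra 𝓘(ℝ, E) G)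
      (γ (a * t + b)) = a • mulInvariantVectorField (X : GroupLieAlgebra 𝓘(ℝ, E) G)
      (γ (a * t + b)) := by
    rw [Submodule.coe_smul, mulInvariantVectorField_smul]; rfl
  rw [h2]
  change ((1 : ℝ) • a) • mulInvariantVectorField (X : GroupLieAlgebra 𝓘(ℝ, E) G) (γ (a * t + b)) =
    (1 : ℝ) • a • mulInvariantVectorField (X : GroupLieAlgebra 𝓘(ℝ, E) G) (γ (a * t + b))
  rw [smul_assoc]

lemma continuousAt_of_continuousOn_diff_finite {u : ℝ → V 1} {F : Set ℝ} (hF : F.Finite)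
    (hu : ContinuousOn u (Ioo 0 1 \ F)) {t : ℝ} (ht : t ∈ Ioo (0 : ℝ) 1 \ F) : ContinuousAt u t :=
  hu.continuousAt ((isOpen_Ioo.sdiff hF.isClosed).mem_nhds ht)

/-- Horizontal curves can be concatenated, and their lengths add up. -/
lemma exists_concat {γ₁ γ₂ : ℝ → G} {u₁ u₂ : ℝ → V 1} (h₁ : IsHorizontalCurve V γ₁ u₁)
    (h₂ : IsHorizontalCurve V γ₂ u₂) (h : γ₁ 1 = γ₂ 0) (ip : InnerProductSpace.Core ℝ (V 1)) :
    ∃ (γ : ℝ → G) (u : ℝ → V 1), IsHorizontalCurve V γ u ∧ γ 0 = γ₁ 0 ∧ γ 1 = γ₂ 1 ∧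
      ∫⁻ t in Icc (0 : ℝ) 1, ENNReal.ofReal (Real.sqrt (ip.inner (u t) (u t))) =
        (∫⁻ t in Icc (0 : ℝ) 1, ENNReal.ofReal (Real.sqrt (ip.inner (u₁ t) (u₁ t)))) +
        ∫⁻ t in Icc (0 : ℝ) 1, ENNReal.ofReal (Real.sqrt (ip.inner (u₂ t) (u₂ t))) := by
  obtain ⟨hc₁, F₁, hF₁, hu₁, hd₁⟩ := h₁
  obtain ⟨hc₂, F₂, hF₂, hu₂, hd₂⟩ := h₂
  set γ : ℝ → G := fun t => if t ≤ 1 / 2 then γ₁ (2 * t + 0) else γ₂ (2 * t + -1) with hγ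
  set u : ℝ → V 1 := fun t => if t ≤ 1 / 2 then (2 : ℝ) • u₁ (2 * t + 0)
    else (2 : ℝ) • u₂ (2 * t + -1) with hu
  set F : Set ℝ := {1 / 2} ∪ ((fun t => 2 * t + 0) ⁻¹' F₁ ∪ (fun t => 2 * t + -1) ⁻¹' F₂) with hF
  have hFfin : F.Finite := by
    refine (finite_singleton _).union ((hF₁.preimage ?_).union (hF₂.preimage ?_)) <;>
    · intro x _ y _ hxy
      simpa using hxy
  -- away from the junction and the singular times, the new curve is locally one of the two pieces
  have hcase : ∀ t ∈ Ioo (0 : ℝ) 1 \ F,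
      (2 * t + 0 ∈ Ioo (0 : ℝ) 1 \ F₁ ∧ γ =ᶠ[𝓝 t] (fun s => γ₁ (2 * s + 0)) ∧
        u =ᶠ[𝓝 t] (fun s => (2 : ℝ) • u₁ (2 * s + 0))) ∨
      (2 * t + -1 ∈ Ioo (0 : ℝ) 1 \ F₂ ∧ γ =ᶠ[𝓝 t] (fun s => γ₂ (2 * s + -1)) ∧
        u =ᶠ[𝓝 t] (fun s => (2 : ℝ) • u₂ (2 * s + -1))) := by
    rintro t ⟨⟨ht0, ht1⟩, htF⟩
    simp only [hF, mem_union, mem_singleton_iff, mem_preimage, not_or] at htF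
    rcases lt_or_gt_of_ne htF.1 with h2 | h2
    · refine Or.inl ⟨⟨⟨by linarith, by linarith⟩, htF.2.1⟩, ?_, ?_⟩ <;>
      · filter_upwards [Iio_mem_nhds h2] with s hs
        simp only [hγ, hu, if_pos (le_of_lt (mem_Iio.1 hs))]
    · refine Or.inr ⟨⟨⟨by linarith, by linarith⟩, htF.2.2⟩, ?_, ?_⟩ <;>
      · filter_upwards [Ioi_mem_nhds h2] with s hs
        have : ¬ s ≤ 1 / 2 := not_le.2 hs
        simp only [hγ, hu, if_neg this]
  refine ⟨γ, u, ⟨?_, F, hFfin, ?_, ?_⟩, by simp [hγ], ?_, ?_⟩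
  · have hunion : Icc (0 : ℝ) 1 = Icc 0 (1 / 2) ∪ Icc (1 / 2) 1 :=
      (Icc_union_Icc_eq_Icc (by norm_num) (by norm_num)).symm
    rw [hunion]
    refine ContinuousOn.union_of_isClosed ?_ ?_ isClosed_Icc isClosed_Icc
    · refine ContinuousOn.congr (f := fun t => γ₁ (2 * t + 0)) ?_ fun t ht => by
        simp only [hγ, if_pos ht.2]
      refine hc₁.comp (by fun_prop) fun t ht => ⟨by linarith [ht.1], by linarith [ht.2]⟩
    · refine ContinuousOn.congr (f := fun t => γ₂ (2 * t + -1)) ?_ fun t ht => ?_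
      · refine hc₂.comp (by fun_prop) fun t ht => ⟨by linarith [ht.1], by linarith [ht.2]⟩
      · rcases ht.1.eq_or_lt with h2 | h2
        · have h3 : (2 : ℝ) * (1 / 2) + 0 = 1 := by norm_num
          have h4 : (2 : ℝ) * (1 / 2) + -1 = 0 := by norm_num
          simp only [hγ, ← h2, le_refl, if_true, h3, h4, h]
        · simp only [hγ, if_neg (not_le.2 h2)]
  · intro t ht
    refine ContinuousAt.continuousWithinAt ?_
    rcases hcase t ht with ⟨h2, -, h3⟩ | ⟨h2, -, h3⟩
    · refine ContinuousAt.congr ?_ h3.symm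
      have h4 := continuousAt_of_continuousOn_diff_finite hF₁ hu₁ h2
      have h5 : ContinuousAt (fun s => u₁ (2 * s + 0)) t :=
        ContinuousAt.comp (f := fun s : ℝ => 2 * s + 0) h4 (by fun_prop)
      exact h5.const_smul (2 : ℝ)
    · refine ContinuousAt.congr ?_ h3.symm
      have h4 := continuousAt_of_continuousOn_diff_finite hF₂ hu₂ h2
      have h5 : ContinuousAt (fun s => u₂ (2 * s + -1)) t :=
        ContinuousAt.comp (f := fun s : ℝ => 2 * s + -1) h4 (by fun_prop)
      exact h5.const_smul (2 : ℝ)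
  · intro t ht
    rcases hcase t ht with ⟨h2, h3, h4⟩ | ⟨h2, h3, h4⟩
    · rw [h3.eq_of_nhds, h4.eq_of_nhds]
      exact (hasMFDerivAt_comp_affine (hd₁ _ h2)).congr_of_eventuallyEq h3
    · rw [h3.eq_of_nhds, h4.eq_of_nhds]
      exact (hasMFDerivAt_comp_affine (hd₂ _ h2)).congr_of_eventuallyEq h3
  · have h3 : ¬ (1 : ℝ) ≤ 1 / 2 := by norm_num
    have h4 : (2 : ℝ) * 1 + -1 = 1 := by norm_num
    simp only [hγ, if_neg h3, h4]
  · have h3 : Ioo (0 : ℝ) 1 = Ioo 0 (1 / 2) ∪ Ico (1 / 2) 1 :=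
      (Ioo_union_Ico_eq_Ioo (by norm_num) (by norm_num)).symm
    have h4 : Disjoint (Ioo (0 : ℝ) (1 / 2)) (Ico (1 / 2) 1) := by
      rw [Set.disjoint_left]; intro x hx hx'; exact absurd hx'.1 (not_le.2 hx.2)
    have hsq : ∀ x : V 1, ENNReal.ofReal (Real.sqrt (ip.inner ((2 : ℝ) • x) ((2 : ℝ) • x))) =
        ENNReal.ofReal 2 * ENNReal.ofReal (Real.sqrt (ip.inner x x)) := fun x => by
      rw [sqrt_inner_smul, abs_of_pos two_pos, ENNReal.ofReal_mul two_pos.le]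
    rw [← restrict_Ioo_eq_restrict_Icc, h3, lintegral_union measurableSet_Ico h4,
      Measure.restrict_congr_set Ioo_ae_eq_Ico.symm, ← h3]
    congr 1
    · rw [restrict_Ioo_eq_restrict_Icc (a := (0 : ℝ)) (b := 1), ← lintegral_comp_affine
        (fun t => ENNReal.ofReal (Real.sqrt (ip.inner (u₁ t) (u₁ t)))) two_pos 0 (1 / 2) (b := 0)
        (by norm_num) (by norm_num)]
      refine setLIntegral_congr_fun measurableSet_Ioo fun t ht => ?_
      simp only [hu, if_pos ht.2.le, hsq]
    · rw [restrict_Ioo_eq_restrict_Icc (a := (0 : ℝ)) (b := 1), ← lintegral_comp_affine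
        (fun t => ENNReal.ofReal (Real.sqrt (ip.inner (u₂ t) (u₂ t)))) two_pos (1 / 2) 1 (b := -1)
        (by norm_num) (by norm_num)]
      refine setLIntegral_congr_fun measurableSet_Ioo fun t ht => ?_
      simp only [hu, if_neg (not_le.2 ht.1), hsq]

lemma carnotDist_triangle (p q r : G) :
    carnotDist V ip p r ≤ carnotDist V ip p q + carnotDist V ip q r := by
  refine ENNReal.le_of_forall_pos_le_add fun ε hε hlt => ?_
  rw [ENNReal.add_lt_top] at hlt
  have hε2 : ((ε / 2 : NNReal) : ℝ≥0∞) ≠ 0 := by simpa using hε.ne'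
  obtain ⟨γ₁, u₁, h₁, h10, h11, hl₁⟩ :=
    exists_of_carnotDist_lt (ENNReal.lt_add_right hlt.1.ne hε2)
  obtain ⟨γ₂, u₂, h₂, h20, h21, hl₂⟩ :=
    exists_of_carnotDist_lt (ENNReal.lt_add_right hlt.2.ne hε2)
  obtain ⟨γ, u, hγ, h0, h1, hl⟩ := exists_concat h₁ h₂ (h11.trans h20.symm) ip
  have h3 := carnotDist_le_of_isHorizontalCurve (ip := ip) hγ
  rw [h0, h1, h10, h21, hl] at h3
  refine h3.trans ((add_le_add hl₁.le hl₂.le).trans_eq ?_)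
  have h4 : (ε : ℝ≥0∞) = ((ε / 2 : NNReal) : ℝ≥0∞) + ((ε / 2 : NNReal) : ℝ≥0∞) := by
    rw [← ENNReal.coe_add, add_halves]
  rw [h4]; ring

end Curves

section Lie

lemma carnotDist_dilation_le {δ : ℝ → G ≃* G} (hδ : IsDilationFamily V δ) {t : ℝ} (ht : 0 < t)
    (p q : G) : carnotDist V ip (δ t p) (δ t q) ≤ ENNReal.ofReal t * carnotDist V ip p q := by
  have ht' : ENNReal.ofReal t ≠ 0 := by simpa using ht
  rw [← ENNReal.div_le_iff' ht' ENNReal.ofReal_ne_top]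
  refine le_carnotDist fun γ u h h0 h1 => ?_
  rw [ENNReal.div_le_iff' ht' ENNReal.ofReal_ne_top]
  obtain ⟨hc, F, hF, hu, hd⟩ := h
  have h2 : IsHorizontalCurve V (fun s => δ t (γ s)) (fun s => t • u s) := by
    refine ⟨(hδ.contMDiff t ht).continuous.comp_continuousOn hc, F, hF, hu.const_smul t,
      fun s hs => ?_⟩
    have h1 := (((hδ.contMDiff t ht).mdifferentiableAt (x := γ s) (by simp)).hasMFDerivAt).comp s
      (hd s hs)
    have h2 := hδ.mfderiv_eq t ht 1 (u s) (u s).2 (γ s)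
    rw [pow_one] at h2
    refine h1.congr_mfderiv (ContinuousLinearMap.ext_ring ?_)
    change mfderiv 𝓘(ℝ, E) 𝓘(ℝ, E) (δ t) (γ s)
      ((1 : ℝ) • mulInvariantVectorField (u s : GroupLieAlgebra 𝓘(ℝ, E) G) (γ s)) =
        (1 : ℝ) • mulInvariantVectorField (t • (u s : GroupLieAlgebra 𝓘(ℝ, E) G)) (δ t (γ s))
    rw [one_smul, one_smul, h2]
  have h3 := carnotDist_le_of_isHorizontalCurve (ip := ip) h2
  simp only [h0, h1] at h3
  refine h3.trans_eq ?_
  rw [← lintegral_const_mul' _ _ ENNReal.ofReal_ne_top]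
  refine lintegral_congr fun s => ?_
  rw [sqrt_inner_smul, abs_of_pos ht, ENNReal.ofReal_mul ht.le]

variable [LieGroup 𝓘(ℝ, E) ∞ G]

lemma carnotDist_mul_left_le (g p q : G) :
    carnotDist V ip (g * p) (g * q) ≤ carnotDist V ip p q := by
  have : ContinuousMul G := ⟨(contMDiff_mul 𝓘(ℝ, E) ∞ (G := G)).continuous⟩
  refine le_carnotDist fun γ u h h0 h1 => ?_
  obtain ⟨hc, F, hF, hu, hd⟩ := h
  have h2 : IsHorizontalCurve V (fun t => g * γ t) u := by
    refine ⟨continuousOn_const.mul hc, F, hF, hu, fun t ht => ?_⟩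
    have h1 := ((mdifferentiableAt_mul_left (E := E) g (γ t)).hasMFDerivAt).comp t (hd t ht)
    have h2 := mfderiv_mul_left_mulInvariantVectorField (E := E) (u t : GroupLieAlgebra 𝓘(ℝ, E) G)
      g (γ t)
    refine h1.congr_mfderiv (ContinuousLinearMap.ext_ring ?_)
    change mfderiv 𝓘(ℝ, E) 𝓘(ℝ, E) (fun x : G => g * x) (γ t)
      ((1 : ℝ) • mulInvariantVectorField (u t : GroupLieAlgebra 𝓘(ℝ, E) G) (γ t)) =
        (1 : ℝ) • mulInvariantVectorField (u t : GroupLieAlgebra 𝓘(ℝ, E) G) (g * γ t)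
    rw [one_smul, one_smul, h2]
  have h3 := carnotDist_le_of_isHorizontalCurve (ip := ip) h2
  simpa only [h0, h1] using h3

lemma carnotDist_mul_left (g p q : G) :
    carnotDist V ip (g * p) (g * q) = carnotDist V ip p q := by
  refine le_antisymm (carnotDist_mul_left_le g p q) ?_
  simpa using carnotDist_mul_left_le (ip := ip) g⁻¹ (g * p) (g * q)

lemma carnotDist_eq_one_inv_mul (p q : G) : carnotDist V ip p q = carnotDist V ip 1 (p⁻¹ * q) := by
  rw [← carnotDist_mul_left p⁻¹ p q, inv_mul_cancel]

lemma carnotDist_one_mul_le (p q : G) :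
    carnotDist V ip 1 (p * q) ≤ carnotDist V ip 1 p + carnotDist V ip 1 q := by
  refine (carnotDist_triangle 1 p (p * q)).trans (add_le_add le_rfl ?_)
  simpa using carnotDist_mul_left_le (ip := ip) p 1 q

lemma carnotDist_one_expCurve_le [CompleteSpace E] [T2Space G] (X : V 1) {t : ℝ} (ht : 0 ≤ t) :
    carnotDist V ip 1 (expCurve (X : GroupLieAlgebra 𝓘(ℝ, E) G) t) ≤
      ENNReal.ofReal (t * Real.sqrt (ip.inner X X)) := by
  have h : IsHorizontalCurve V (expCurve ((t • X : V 1) : GroupLieAlgebra 𝓘(ℝ, E) G))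
      (fun _ => t • X) :=
    ⟨(continuous_expCurve _).continuousOn, ∅, finite_empty, continuousOn_const,
      fun s _ => isMIntegralCurve_expCurve _ s⟩
  have h1 := carnotDist_le_of_isHorizontalCurve (ip := ip) h
  rw [expCurve_zero, Submodule.coe_smul, expCurve_smul, one_mul] at h1
  refine h1.trans_eq ?_
  rw [setLIntegral_const, sqrt_inner_smul, abs_of_nonneg ht]
  simp

lemma carnotDist_one_one [CompleteSpace E] [T2Space G] : carnotDist V ip (1 : G) 1 = 0 := by
  simpa using carnotDist_one_expCurve_le (ip := ip) (0 : V 1) le_rfl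

/-- Small balls of the Carnot distance are small: a bump function equal to `1` at the identity
varies little along short horizontal curves. -/
lemma exists_carnotDist_lt_imp_mem [FiniteDimensional ℝ E] [T2Space G]
    (ip : InnerProductSpace.Core ℝ (V 1)) {U : Set G} (hU : U ∈ 𝓝 (1 : G)) :
    ∃ ε : ℝ, 0 < ε ∧ ∀ q, carnotDist V ip 1 q < ENNReal.ofReal ε → q ∈ U := by
  obtain ⟨f, -, hf⟩ := (SmoothBumpFunction.nhds_basis_support (I := 𝓘(ℝ, E)) hU).mem_iff.1 hU
  have hfs : ContMDiff 𝓘(ℝ, E) 𝓘(ℝ, ℝ) ∞ f := f.contMDiff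
  obtain ⟨M, hM0, hM⟩ := exists_forall_abs_lieDeriv_le hfs
    (fun X => hasCompactSupport_lieDeriv f.hasCompactSupport X)
  have : FiniteDimensional ℝ (GroupLieAlgebra 𝓘(ℝ, E) G) := inferInstanceAs (FiniteDimensional ℝ E)
  let L : V 1 →ₗ[ℝ] E := (V 1).subtype
  obtain ⟨C, hC0, hC⟩ := exists_norm_le_sqrt_inner ip L
  refine ⟨1 / (M * C + 1), by positivity, fun q hq => ?_⟩
  obtain ⟨γ, u, ⟨hc, F, hF, hu, hd⟩, h0, h1, hlen⟩ := exists_of_carnotDist_lt hq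
  set g : ℝ → ℝ := fun t => lieDeriv (u t : GroupLieAlgebra 𝓘(ℝ, E) G) f (γ t) with hg
  have hbound : ∀ t, ‖g t‖ₑ ≤
      ENNReal.ofReal (M * C) * ENNReal.ofReal (Real.sqrt (ip.inner (u t) (u t))) := by
    intro t
    rw [← ENNReal.ofReal_mul (by positivity), ← ofReal_norm]
    refine ENNReal.ofReal_le_ofReal ?_
    calc ‖g t‖ ≤ M * ‖L (u t)‖ := hM (L (u t)) (γ t)
      _ ≤ M * (C * Real.sqrt (ip.inner (u t) (u t))) := by
        gcongr; exact hC _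
      _ = M * C * Real.sqrt (ip.inner (u t) (u t)) := by ring
  have hgc : ContinuousOn g (Ioo 0 1 \ F) := by
    have hL : Continuous L := continuous_subtype_val
    have hγc : ContinuousOn γ (Ioo 0 1 \ F) := hc.mono (sdiff_subset.trans Ioo_subset_Icc_self)
    have hsum : g = fun t => ∑ i, (Module.finBasis ℝ E).coord i (L (u t)) *
        lieDeriv (E := E) (Module.finBasis ℝ E i) f (γ t) :=
      funext fun t => lieDeriv_eq_sum f (γ t) (L (u t))
    rw [hsum]
    refine continuousOn_finsetSum _ fun i _ => ContinuousOn.mul ?_ ?_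
    · exact (((Module.finBasis ℝ E).coord i).continuous_of_finiteDimensional.comp
        hL).comp_continuousOn hu
    · exact (continuous_lieDeriv hfs _).comp_continuousOn hγc
  have hopen : IsOpen (Ioo (0 : ℝ) 1 \ F) := isOpen_Ioo.sdiff hF.isClosed
  have hae : (Ioo (0 : ℝ) 1 \ F : Set ℝ) =ᵐ[volume] Ioc (0 : ℝ) 1 :=
    (sdiff_null_ae_eq_self (hF.measure_zero _)).trans Ioo_ae_eq_Ioc
  have hlt : ∫⁻ t in Ioc (0 : ℝ) 1, ‖g t‖ₑ < 1 := by
    rw [Measure.restrict_congr_set Ioc_ae_eq_Icc]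
    refine (lintegral_mono hbound).trans_lt ?_
    rw [lintegral_const_mul' _ _ ENNReal.ofReal_ne_top]
    refine (mul_le_mul_right hlen.le _).trans_lt ?_
    rw [← ENNReal.ofReal_mul (by positivity), ENNReal.ofReal_lt_one, mul_one_div,
      div_lt_one (by positivity)]
    linarith
  have hint : IntervalIntegrable g volume 0 1 := by
    rw [intervalIntegrable_iff_integrableOn_Ioc_of_le zero_le_one]
    refine ⟨?_, hlt.trans ENNReal.one_lt_top⟩
    rw [← Measure.restrict_congr_set hae]
    exact hgc.aestronglyMeasurable hopen.measurableSet
  have hFTC : ∫ t in (0 : ℝ)..1, g t = f (γ 1) - f (γ 0) := by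
    refine integral_eq_of_hasDerivAt_off_countable (fun t => f (γ t)) g hF.countable ?_ ?_ hint
    · rw [uIcc_of_le zero_le_one]
      exact f.continuous.comp_continuousOn hc
    · intro t ht
      rw [min_eq_left zero_le_one, max_eq_right zero_le_one] at ht
      exact hasDerivAt_comp_curve (hfs.mdifferentiableAt (by simp)) (hd t ht)
  rw [h0, h1, f.eq_one, intervalIntegral.integral_of_le zero_le_one] at hFTC
  have habs : ‖f q - 1‖ₑ < 1 := by
    rw [← hFTC]
    exact (enorm_integral_le_lintegral_enorm _).trans_lt hlt
  refine hf ?_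
  rw [Function.mem_support]
  intro h2
  rw [h2] at habs
  simp at habs

end Lie

/-! ### Dilations and homogeneous norms -/

/-- The dilations, extended to `t ≤ 0` by the trivial homomorphism. In contrast with `δ` itself,
this extension is jointly continuous on `ℝ × G`. -/
noncomputable def dil {G : Type*} [Group G] (δ : ℝ → G ≃* G) (t : ℝ) : G →* G :=
  if 0 < t then (δ t).toMonoidHom else 1

lemma dil_of_pos {G : Type*} [Group G] (δ : ℝ → G ≃* G) {t : ℝ} (ht : 0 < t) (x : G) :
    dil δ t x = δ t x := by
  simp [dil, ht]

lemma dil_of_nonpos {G : Type*} [Group G] (δ : ℝ → G ≃* G) {t : ℝ} (ht : t ≤ 0) (x : G) :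
    dil δ t x = 1 := by
  simp [dil, not_lt.2 ht]

/-- `ℓ` is a finite gauge which is subadditive, homogeneous with respect to the multiplicative
one-parameter group `δ`, and whose sublevel sets form a basis of neighborhoods of the identity.
No symmetry `ℓ x⁻¹ = ℓ x` is required. -/
structure IsHomogeneousGauge {G : Type*} [TopologicalSpace G] [Group G] (δ : ℝ → G ≃* G)
    (ℓ : G → ℝ≥0∞) : Prop where
  dilation_dilation : ∀ s t : ℝ, 0 < s → 0 < t → ∀ x, δ s (δ t x) = δ (s * t) x
  continuous_dil : Continuous fun z : ℝ × G => dil δ z.1 z.2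
  mul_le : ∀ x y, ℓ (x * y) ≤ ℓ x + ℓ y
  dilation : ∀ t : ℝ, 0 < t → ∀ x, ℓ (δ t x) = ENNReal.ofReal t * ℓ x
  ne_top : ∀ x, ℓ x ≠ ⊤
  mem_nhds : ∀ ε : ℝ, 0 < ε → {x | ℓ x < ENNReal.ofReal ε} ∈ 𝓝 1
  exists_lt_imp_mem : ∀ U ∈ 𝓝 (1 : G), ∃ ε : ℝ, 0 < ε ∧ ∀ x, ℓ x < ENNReal.ofReal ε → x ∈ U

section Dilations

variable [CompleteSpace E] [T2Space G] [LieGroup 𝓘(ℝ, E) ∞ G]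
  {V : ℕ → Submodule ℝ (GroupLieAlgebra 𝓘(ℝ, E) G)} {W : Set (GroupLieAlgebra 𝓘(ℝ, E) G)}
  {δ : ℝ → G ≃* G} {ip : InnerProductSpace.Core ℝ (V 1)}

lemma IsDilationFamily.dilation_expCurve (hδ : IsDilationFamily V δ) {t : ℝ} (ht : 0 < t)
    {X : GroupLieAlgebra 𝓘(ℝ, E) G} (hX : X ∈ V 1) (s : ℝ) :
    δ t (expCurve X s) = expCurve X (t * s) := by
  have h := eq_expCurve (γ := fun s => δ t (expCurve X s)) (X := t • X)
    (by simp [expCurve_zero]) (fun s => by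
      have h1 := (((hδ.contMDiff t ht).mdifferentiableAt (x := expCurve X s)
        (by simp)).hasMFDerivAt).comp s (isMIntegralCurve_expCurve X s)
      have h2 := hδ.mfderiv_eq t ht 1 X hX (expCurve X s)
      rw [pow_one] at h2
      refine h1.congr_mfderiv (ContinuousLinearMap.ext_ring ?_)
      change mfderiv 𝓘(ℝ, E) 𝓘(ℝ, E) (δ t) (expCurve X s)
        ((1 : ℝ) • mulInvariantVectorField X (expCurve X s)) =
          (1 : ℝ) • mulInvariantVectorField (t • X) (δ t (expCurve X s))
      rw [one_smul, one_smul, h2])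
  have h3 := congrFun h s
  rw [expCurve_smul, mul_comm] at h3
  exact h3

lemma IsDilationFamily.dil_expCurve (hδ : IsDilationFamily V δ) {X : GroupLieAlgebra 𝓘(ℝ, E) G}
    (hX : X ∈ V 1) (s t : ℝ) : dil δ t (expCurve X s) = expCurve X (max t 0 * s) := by
  rcases lt_or_ge 0 t with ht | ht
  · rw [dil_of_pos δ ht, hδ.dilation_expCurve ht hX, max_eq_left ht.le]
  · rw [dil_of_nonpos δ ht, max_eq_right ht, zero_mul, expCurve_zero]

lemma IsDilationFamily.image_semigroupGen_subset (hδ : IsDilationFamily V δ)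
    (hW : IsHorizontalHalfSpace V W) {t : ℝ} (ht : 0 < t) :
    δ t '' (semigroupGen W : Set G) ⊆ semigroupGen W := by
  rw [image_subset_iff]
  refine (Subsemigroup.closure_le
    (S := (semigroupGen W).comap ((δ t).toMonoidHom : G →ₙ* G))).2 ?_
  rw [expSet_eq]
  rintro _ ⟨X, hX, rfl⟩
  change δ t (expCurve X 1) ∈ semigroupGen W
  rw [hδ.dilation_expCurve ht (hW.mem_layer hX)]
  exact hW.expCurve_mem hX (by linarith)

variable [FiniteDimensional ℝ E]

lemma interior_semigroupGen_nonempty [ContinuousMul G] (hV : IsStratification V)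
    (hW : IsHorizontalHalfSpace V W) : (interior (semigroupGen W : Set G)).Nonempty := by
  obtain ⟨R, -, h⟩ := exists_nonempty_interior_semigroupGen hV hW (ℓ := fun _ => 0)
    (by simp) (by simp) (fun X _ => ⟨0, by simp, by simp⟩)
  exact h.mono (interior_mono inter_subset_left)

/-- A connected group is generated by the one-parameter subgroups tangent to the first layer: the
subgroup which they generate contains `S_W`, so it is open. -/
lemma subgroup_eq_top [IsTopologicalGroup G] [ConnectedSpace G] (hV : IsStratification V)
    (hW : IsHorizontalHalfSpace V W) (H : Subgroup G)
    (hH : ∀ X ∈ V 1, ∀ t, expCurve X t ∈ H) : H = ⊤ := by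
  obtain ⟨g, hg⟩ := interior_semigroupGen_nonempty hV hW
  have hsub : (semigroupGen W : Set G) ⊆ H := by
    refine (Subsemigroup.closure_le (S := H.toSubmonoid.toSubsemigroup)).2 ?_
    rw [expSet_eq]
    rintro _ ⟨X, hX, rfl⟩
    exact hH X (hW.mem_layer hX) 1
  have ho : IsOpen (H : Set G) :=
    H.isOpen_of_mem_nhds (g := g) (mem_of_superset (mem_interior_iff_mem_nhds.1 hg) hsub)
  have hc : IsClopen (H : Set G) := (⟨H, ho⟩ : OpenSubgroup G).isClopen
  rw [← SetLike.coe_set_eq]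
  exact hc.eq_univ ⟨1, H.one_mem⟩

variable [IsTopologicalGroup G] [ConnectedSpace G]

lemma IsDilationFamily.dilation_dilation (hδ : IsDilationFamily V δ) (hV : IsStratification V)
    (hW : IsHorizontalHalfSpace V W) {s t : ℝ} (hs : 0 < s) (ht : 0 < t) (x : G) :
    δ s (δ t x) = δ (s * t) x := by
  let H : Subgroup G := MonoidHom.eqLocus ((δ s).toMonoidHom.comp (δ t).toMonoidHom)
    (δ (s * t)).toMonoidHom
  have hH : H = ⊤ := subgroup_eq_top hV hW H fun X hX r => by
    change δ s (δ t (expCurve X r)) = δ (s * t) (expCurve X r)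
    rw [hδ.dilation_expCurve ht hX, hδ.dilation_expCurve hs hX,
      hδ.dilation_expCurve (mul_pos hs ht) hX, mul_assoc]
  exact (hH ▸ Subgroup.mem_top x : x ∈ H)

lemma IsDilationFamily.continuous_dil_left (hδ : IsDilationFamily V δ) (hV : IsStratification V)
    (hW : IsHorizontalHalfSpace V W) (x : G) : Continuous fun t => dil δ t x := by
  let H : Subgroup G :=
    { carrier := {x | Continuous fun t => dil δ t x}
      mul_mem' := fun {a b} ha hb => by
        simp only [mem_ofPred_eq, map_mul] at *
        exact ha.mul hb
      one_mem' := by simpa using continuous_const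
      inv_mem' := fun {a} ha => by
        simp only [mem_ofPred_eq, map_inv] at *
        exact ha.inv }
  have hH : H = ⊤ := subgroup_eq_top hV hW H fun X hX r => by
    change Continuous fun t => dil δ t (expCurve X r)
    simp only [hδ.dil_expCurve hX]
    exact (continuous_expCurve X).comp (by fun_prop)
  exact (hH ▸ Subgroup.mem_top x : x ∈ H)

lemma carnotDist_one_dilation (hδ : IsDilationFamily V δ) (hV : IsStratification V)
    (hW : IsHorizontalHalfSpace V W) (ip : InnerProductSpace.Core ℝ (V 1)) {t : ℝ} (ht : 0 < t)
    (x : G) : carnotDist V ip 1 (δ t x) = ENNReal.ofReal t * carnotDist V ip 1 x := by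
  have ht' : ENNReal.ofReal t ≠ 0 := by simpa using ht
  have h1 := carnotDist_dilation_le (ip := ip) hδ ht 1 x
  rw [map_one] at h1
  refine le_antisymm h1 ?_
  have h2 := carnotDist_dilation_le (ip := ip) hδ (inv_pos.2 ht) 1 (δ t x)
  have h3 : δ t⁻¹ (δ t x) = x := by
    apply (δ t).injective
    rw [hδ.dilation_dilation hV hW ht (inv_pos.2 ht), mul_inv_cancel₀ ht.ne']
    apply (δ 1).injective
    rw [hδ.dilation_dilation hV hW one_pos one_pos, one_mul]
  rw [map_one, h3, ENNReal.ofReal_inv_of_pos ht] at h2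
  calc ENNReal.ofReal t * carnotDist V ip 1 x
      ≤ ENNReal.ofReal t * ((ENNReal.ofReal t)⁻¹ * carnotDist V ip 1 (δ t x)) := by gcongr
    _ = carnotDist V ip 1 (δ t x) := by
      rw [← mul_assoc, ENNReal.mul_inv_cancel ht' ENNReal.ofReal_ne_top, one_mul]

/-- The Carnot balls are neighborhoods of their centre. The points of `S_W` whose distance to `1`,
in both directions, is bounded contain an open set; translating it to `1` gives a bounded
neighborhood of `1`, which dilations shrink. -/
lemma setOf_carnotDist_lt_mem_nhds (hδ : IsDilationFamily V δ) (hV : IsStratification V)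
    (hW : IsHorizontalHalfSpace V W) (ip : InnerProductSpace.Core ℝ (V 1)) {ε : ℝ} (hε : 0 < ε) :
    {x : G | carnotDist V ip 1 x < ENNReal.ofReal ε} ∈ 𝓝 1 := by
  obtain ⟨R, hR, g, hg⟩ := exists_nonempty_interior_semigroupGen hV hW
    (ℓ := fun x => carnotDist V ip 1 x + carnotDist V ip 1 x⁻¹)
    (fun x y => by
      simp only [mul_inv_rev]
      refine (add_le_add (carnotDist_one_mul_le x y) (carnotDist_one_mul_le y⁻¹ x⁻¹)).trans_eq ?_
      ring)
    (by simp [carnotDist_one_one])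
    (fun X hX => ⟨
      ENNReal.ofReal (2 * Real.sqrt (ip.inner ⟨X, hW.mem_layer hX⟩ ⟨X, hW.mem_layer hX⟩)) +
      ENNReal.ofReal (2 * Real.sqrt (ip.inner (-⟨X, hW.mem_layer hX⟩) (-⟨X, hW.mem_layer hX⟩))),
      ENNReal.add_ne_top.2 ⟨ENNReal.ofReal_ne_top, ENNReal.ofReal_ne_top⟩, fun t ht => by
        have h1 := carnotDist_one_expCurve_le (ip := ip) ⟨X, hW.mem_layer hX⟩ ht.1
        have h2 := carnotDist_one_expCurve_le (ip := ip) (-⟨X, hW.mem_layer hX⟩) ht.1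
        have h3 : expCurve ((-⟨X, hW.mem_layer hX⟩ : V 1) : GroupLieAlgebra 𝓘(ℝ, E) G) t =
            (expCurve X t)⁻¹ := by
          rw [← expCurve_neg]
          have := expCurve_smul X (-1) t
          simpa using this
        rw [h3] at h2
        refine add_le_add (h1.trans (ENNReal.ofReal_le_ofReal ?_))
          (h2.trans (ENNReal.ofReal_le_ofReal ?_)) <;>
        exact mul_le_mul_of_nonneg_right ht.2 (Real.sqrt_nonneg _)⟩)
  have hgm := interior_subset hg
  have hU : {x : G | carnotDist V ip 1 x ≤ R + R} ∈ 𝓝 1 := by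
    have h1 : (fun x => g * x) ⁻¹'
        ((semigroupGen W : Set G) ∩ {x | carnotDist V ip 1 x + carnotDist V ip 1 x⁻¹ ≤ R}) ∈
          𝓝 (1 : G) := by
      refine (continuous_const_mul g).continuousAt.preimage_mem_nhds ?_
      rw [mul_one]
      exact mem_interior_iff_mem_nhds.1 hg
    filter_upwards [h1] with x hx
    have h2 := carnotDist_one_mul_le (ip := ip) g⁻¹ (g * x)
    rw [inv_mul_cancel_left] at h2
    exact h2.trans (add_le_add (le_add_self.trans hgm.2) (le_self_add.trans hx.2))
  have hRR : R + R ≠ ⊤ := ENNReal.add_ne_top.2 ⟨hR, hR⟩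
  -- the factor by which the bounded neighborhood is shrunk into the ball of radius `ε`
  set c : ℝ := ((R + R).toReal + 1) / ε with hc
  have hR0 : 0 ≤ (R + R).toReal := ENNReal.toReal_nonneg
  have hc0 : 0 < c := by positivity
  have h2 : δ c ⁻¹' {x : G | carnotDist V ip 1 x ≤ R + R} ∈ 𝓝 1 := by
    refine (hδ.contMDiff c hc0).continuous.continuousAt.preimage_mem_nhds ?_
    rw [map_one]; exact hU
  filter_upwards [h2] with x hx
  simp only [mem_preimage, mem_ofPred_eq] at hx ⊢
  rw [carnotDist_one_dilation hδ hV hW ip hc0] at hx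
  by_contra! h3
  have h4 := (mul_le_mul_right h3 (ENNReal.ofReal c)).trans hx
  rw [← ENNReal.ofReal_mul hc0.le, ← ENNReal.ofReal_toReal hRR,
    ENNReal.ofReal_le_ofReal_iff hR0, hc, div_mul_cancel₀ _ hε.ne'] at h4
  linarith

lemma isHomogeneousGauge_carnotDist (hδ : IsDilationFamily V δ) (hV : IsStratification V)
    (hW : IsHorizontalHalfSpace V W) (ip : InnerProductSpace.Core ℝ (V 1)) :
    IsHomogeneousGauge δ (carnotDist V ip (1 : G)) where
  dilation_dilation s t hs ht x := hδ.dilation_dilation hV hW hs ht x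
  mul_le := carnotDist_one_mul_le
  dilation t ht x := carnotDist_one_dilation hδ hV hW ip ht x
  mem_nhds ε hε := setOf_carnotDist_lt_mem_nhds hδ hV hW ip hε
  exists_lt_imp_mem U hU := exists_carnotDist_lt_imp_mem ip hU
  ne_top x := by
    have h1 : Tendsto (fun t => dil δ t x) (𝓝[>] 0) (𝓝 1) := by
      have := (hδ.continuous_dil_left hV hW x).tendsto 0
      rw [dil_of_nonpos δ le_rfl] at this
      exact this.mono_left nhdsWithin_le_nhds
    obtain ⟨t, ht, ht0⟩ := ((h1.eventually
      (setOf_carnotDist_lt_mem_nhds hδ hV hW ip one_pos)).and self_mem_nhdsWithin).exists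
    change 0 < t at ht0
    simp only [dil_of_pos δ ht0, carnotDist_one_dilation hδ hV hW ip ht0] at ht
    intro h
    rw [h, ENNReal.mul_top (by simpa using ht0)] at ht
    exact not_top_lt ht
  continuous_dil := by
    refine continuous_iff_continuousAt.2 fun ⟨t₀, x₀⟩ => ?_
    -- it suffices to treat points near the identity, where the gauge controls everything
    have h1 : Tendsto (fun z : ℝ × G => dil δ z.1 (x₀⁻¹ * z.2)) (𝓝 (t₀, x₀)) (𝓝 1) := by
      intro U hU
      obtain ⟨ε, hε, hεU⟩ := exists_carnotDist_lt_imp_mem ip hU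
      have hη : 0 < ε / (|t₀| + 1) := by positivity
      have h2 : ∀ᶠ z : ℝ × G in 𝓝 (t₀, x₀), z.1 < |t₀| + 1 :=
        continuous_fst.continuousAt.eventually_lt continuousAt_const
          (by linarith [le_abs_self t₀])
      have h3 : ∀ᶠ z : ℝ × G in 𝓝 (t₀, x₀),
          carnotDist V ip 1 (x₀⁻¹ * z.2) < ENNReal.ofReal (ε / (|t₀| + 1)) := by
        have h4 : ContinuousAt (fun z : ℝ × G => x₀⁻¹ * z.2) (t₀, x₀) := by fun_prop
        refine h4.eventually_mem (s := {x | carnotDist V ip 1 x < _}) ?_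
        simpa using setOf_carnotDist_lt_mem_nhds hδ hV hW ip hη
      rw [mem_map]
      filter_upwards [h2, h3] with z hz hz'
      refine hεU _ ?_
      dsimp only
      rcases lt_or_ge 0 z.1 with h0 | h0
      · rw [dil_of_pos δ h0, carnotDist_one_dilation hδ hV hW ip h0]
        refine (ENNReal.mul_lt_mul_right (by simpa using h0) ENNReal.ofReal_ne_top hz').trans_le ?_
        rw [← ENNReal.ofReal_mul h0.le]
        refine ENNReal.ofReal_le_ofReal ?_
        rw [mul_div_assoc', div_le_iff₀ (by positivity), mul_comm]
        gcongr
      · rw [dil_of_nonpos δ h0, carnotDist_one_one]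
        simpa using hε
    have h2 : ContinuousAt (fun z : ℝ × G => dil δ z.1 x₀) (t₀, x₀) :=
      ((hδ.continuous_dil_left hV hW x₀).comp continuous_fst).continuousAt
    have h3 := h2.tendsto.mul h1
    rw [mul_one] at h3
    refine h3.congr fun z => ?_
    rw [← map_mul, mul_inv_cancel_left]

end Dilations

end LieGroup

/-! ### Sets which are almost everywhere invariant under a semigroup -/

section EssInterior

variable {G : Type*} [TopologicalSpace G] [MeasurableSpace G] {μ : Measure G} {A : Set G}

/-- The essential interior of `A`: the points which have a neighborhood almost all of which lies
in `A`. The complement of `essInterior μ Aᶜ` is the measure-theoretic support of `A`. -/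
def essInterior (μ : Measure G) (A : Set G) : Set G :=
  {p | ∃ U ∈ 𝓝 p, μ (U \ A) = 0}

lemma isOpen_essInterior : IsOpen (essInterior μ A) := by
  refine isOpen_iff_mem_nhds.2 fun p hp => ?_
  obtain ⟨U, hU, h⟩ := hp
  exact mem_of_superset (eventually_mem_nhds_iff.2 hU) fun q hq => ⟨U, hq, h⟩

lemma measure_essInterior_diff [SecondCountableTopology G] : μ (essInterior μ A \ A) = 0 := by
  refine measure_null_of_locally_null _ fun p hp => ?_
  obtain ⟨U, hU, h⟩ := hp.1
  exact ⟨U ∩ (essInterior μ A \ A), inter_mem (mem_nhdsWithin_of_mem_nhds hU) self_mem_nhdsWithin,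
    measure_mono_null (t := U \ A) (fun x hx => ⟨hx.1, hx.2.2⟩) h⟩

lemma essInterior_ne_univ [SecondCountableTopology G] (h : μ Aᶜ ≠ 0) : essInterior μ A ≠ univ := by
  intro h1
  apply h
  rw [compl_eq_univ_sdiff, ← h1]
  exact measure_essInterior_diff

lemma closure_essInterior_subset [μ.IsOpenPosMeasure] :
    closure (essInterior μ A) ⊆ (essInterior μ Aᶜ)ᶜ := by
  refine closure_minimal ?_ isOpen_essInterior.isClosed_compl
  rintro p ⟨U, hU, hU0⟩ ⟨U', hU', hU0'⟩
  have h1 : μ (U ∩ U') = 0 := by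
    refine measure_mono_null (fun x hx => ?_) (measure_union_null hU0 hU0')
    by_cases hxA : x ∈ A
    · exact Or.inr ⟨hx.2, fun h => h hxA⟩
    · exact Or.inl ⟨hx.1, hxA⟩
  exact (Measure.measure_pos_of_mem_nhds μ (inter_mem hU hU')).ne' h1

end EssInterior

section Stable

lemma compl_mul_inv_subset {G : Type*} [Group G] {S F : Set G} (h : F * S ⊆ F) : Fᶜ * S⁻¹ ⊆ Fᶜ := by
  rintro _ ⟨p, hp, k, hk, rfl⟩ hF
  exact hp (by simpa using h (mul_mem_mul hF hk))

/-- An open set stable under right multiplication by `S` is stable under right multiplication by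
the closure of `S`. -/
lemma mul_closure_subset {G : Type*} [TopologicalSpace G] [Group G]
    [IsTopologicalGroup G] {S F : Set G} (hF : IsOpen F) (h : F * S ⊆ F) : F * closure S ⊆ F := by
  rintro _ ⟨p, hp, k, hk, rfl⟩
  have h1 : ContinuousAt (fun s => p * k * s⁻¹) k := by fun_prop
  obtain ⟨s, hs, hsS⟩ := mem_closure_iff_nhds.1 hk _
    (h1.preimage_mem_nhds (hF.mem_nhds (by simpa using hp)))
  simpa using h (mul_mem_mul hs hsS)

end Stable

section Invariant

variable {G : Type*} [TopologicalSpace G] [Group G] [IsTopologicalGroup G]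
  [SecondCountableTopology G] [MeasurableSpace G] [BorelSpace G]
  {μ : Measure G} [SFinite μ] [μ.IsMulLeftInvariant] {A S O : Set G}

lemma measure_diff_preimage_mul_right_compl {h : G}
    (hA : μ (A \ (fun x => x * h) ⁻¹' A) = 0) :
    μ (Aᶜ \ (fun x => x * h⁻¹) ⁻¹' Aᶜ) = 0 := by
  rw [← measure_mul_right_null μ h]
  refine measure_mono_null (fun x hx => ?_) hA
  have h1 : x * h ∉ A ∧ ¬ x * h * h⁻¹ ∉ A := hx
  rw [mul_inv_cancel_right, not_not] at h1
  exact ⟨h1.2, h1.1⟩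

/-- By Fubini's theorem, the right translations by an open set of group elements under which `A`
is almost everywhere invariant carry the support of `A` into the essential interior of `A`. -/
lemma mul_mem_essInterior (hAm : MeasurableSet A) (hO : IsOpen O)
    (hA : ∀ h ∈ O, μ (A \ (fun x => x * h) ⁻¹' A) = 0) {p h : G} (hp : p ∉ essInterior μ Aᶜ)
    (hh : h ∈ O) : p * h ∈ essInterior μ A := by
  have h1 : ContinuousAt (fun z : G × G => z.1⁻¹ * z.2) (p, p * h) := by fun_prop
  have h2 : (fun z : G × G => z.1⁻¹ * z.2) ⁻¹' O ∈ 𝓝 (p, p * h) :=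
    h1.preimage_mem_nhds (hO.mem_nhds (by simpa using hh))
  rw [nhds_prod_eq, mem_prod_iff] at h2
  obtain ⟨U', hU', N', hN', hUN'⟩ := h2
  obtain ⟨U, hUU', hUo, hpU⟩ := mem_nhds_iff.1 hU'
  obtain ⟨N, hNN', hNo, hpN⟩ := mem_nhds_iff.1 hN'
  refine ⟨N, hNo.mem_nhds hpN, ?_⟩
  have hB : μ (U ∩ A) ≠ 0 := fun h0 =>
    hp ⟨U, hUo.mem_nhds hpU, by rwa [sdiff_compl]⟩
  have hBm : MeasurableSet (U ∩ A) := hUo.measurableSet.inter hAm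
  have hCm : MeasurableSet (N \ A) := hNo.measurableSet.diff hAm
  have h3 := measurePreserving_prod_mul_swap μ μ
  have h4 := h3.measure_preimage (hBm.prod hCm).nullMeasurableSet
  rw [Measure.prod_prod, Measure.measure_prod_null_of_ae_null (h3.measurable (hBm.prod hCm))] at h4
  · exact (mul_eq_zero.1 h4.symm).resolve_left hB
  · refine Eventually.of_forall fun k => ?_
    by_cases hk : k ∈ O
    · exact measure_mono_null (t := A \ (fun x => x * k) ⁻¹' A)
        (fun x hx => ⟨hx.1.2, hx.2.2⟩) (hA k hk)
    · refine measure_mono_null (fun x hx => hk ?_) (measure_empty (μ := μ))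
      have h5 := hUN' (mk_mem_prod (hUU' hx.1.1) (hNN' hx.2.1))
      simpa using h5

lemma essInterior_mul_subset (hA : ∀ h ∈ S, μ (A \ (fun x => x * h) ⁻¹' A) = 0) :
    essInterior μ A * S ⊆ essInterior μ A := by
  rintro _ ⟨p, hp, h, hh, rfl⟩
  obtain ⟨U, hU, hU0⟩ := hp
  refine ⟨(fun x => x * h⁻¹) ⁻¹' U, ?_, ?_⟩
  · exact (continuous_mul_const h⁻¹).continuousAt.preimage_mem_nhds (by simpa using hU)
  · rw [← measure_mul_right_null μ h]
    refine measure_mono_null (fun x hx => ?_) (measure_union_null hU0 (hA h hh))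
    replace hx : x * h * h⁻¹ ∈ U ∧ x * h ∉ A := hx
    rw [mul_inv_cancel_right] at hx
    by_cases hxA : x ∈ A
    · exact Or.inr ⟨hxA, hx.2⟩
    · exact Or.inl ⟨hx.1, hxA⟩

lemma isRegularlyOpen_essInterior [μ.IsOpenPosMeasure] (hAm : MeasurableSet A)
    (hA : ∀ h ∈ S, μ (A \ (fun x => x * h) ⁻¹' A) = 0) (h1 : (1 : G) ∈ closure (interior S)) :
    IsRegularlyOpen (essInterior μ A) := by
  refine subset_antisymm (interior_maximal subset_closure isOpen_essInterior) fun p hp => ?_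
  have h2 : ContinuousAt (fun s : G => p * s⁻¹) 1 := by fun_prop
  obtain ⟨s, hs, hsS⟩ := mem_closure_iff_nhds.1 h1 _
    (h2.preimage_mem_nhds (isOpen_interior.mem_nhds (by simpa using hp)))
  have h3 := mul_mem_essInterior hAm isOpen_interior (fun h hh => hA h (interior_subset hh))
    (closure_essInterior_subset (interior_subset hs)) hsS
  simpa using h3

lemma essInterior_nonempty (hAm : MeasurableSet A) (hS : (interior S).Nonempty)
    (hA : ∀ h ∈ S, μ (A \ (fun x => x * h) ⁻¹' A) = 0) (h : μ A ≠ 0) :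
    (essInterior μ A).Nonempty := by
  obtain ⟨p, hp⟩ := (ne_univ_iff_exists_notMem _).1
    (essInterior_ne_univ (μ := μ) (A := Aᶜ) (by rwa [compl_compl]))
  obtain ⟨s, hs⟩ := hS
  exact ⟨p * s, mul_mem_essInterior hAm isOpen_interior
    (fun h hh => hA h (interior_subset hh)) hp hs⟩

end Invariant

/-! ### Points of density -/

namespace IsHomogeneousGauge

section Top

variable {G : Type*} [TopologicalSpace G] [Group G] {δ : ℝ → G ≃* G} {ℓ : G → ℝ≥0∞} {S : Set G}

lemma dilation_one (hℓ : IsHomogeneousGauge δ ℓ) (x : G) : δ 1 x = x := by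
  apply (δ 1).injective
  rw [hℓ.dilation_dilation 1 1 one_pos one_pos, one_mul]

lemma dilation_inv (hℓ : IsHomogeneousGauge δ ℓ) {t : ℝ} (ht : 0 < t) (x : G) :
    δ t⁻¹ (δ t x) = x := by
  rw [hℓ.dilation_dilation _ _ (inv_pos.2 ht) ht, inv_mul_cancel₀ ht.ne', hℓ.dilation_one]

lemma symm_apply (hℓ : IsHomogeneousGauge δ ℓ) {t : ℝ} (ht : 0 < t) (x : G) :
    (δ t).symm x = δ t⁻¹ x := by
  rw [MulEquiv.symm_apply_eq]
  have h := hℓ.dilation_inv (inv_pos.2 ht) x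
  rwa [inv_inv, eq_comm] at h

lemma continuous_dilation (hℓ : IsHomogeneousGauge δ ℓ) {t : ℝ} (ht : 0 < t) :
    Continuous (δ t) := by
  have h : Continuous fun x => dil δ t x := hℓ.continuous_dil.comp (Continuous.prodMk_right t)
  exact h.congr fun x => dil_of_pos δ ht x

/-- The dilation of factor `t > 0` as a homeomorphism. -/
def dilationHomeomorph (hℓ : IsHomogeneousGauge δ ℓ) {t : ℝ} (ht : 0 < t) : G ≃ₜ G where
  toEquiv := (δ t).toEquiv
  continuous_toFun := hℓ.continuous_dilation ht
  continuous_invFun := (hℓ.continuous_dilation (inv_pos.2 ht)).congr fun x =>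
    (hℓ.symm_apply ht x).symm

lemma image_eq_of_forall_subset (hℓ : IsHomogeneousGauge δ ℓ) (hS : ∀ t, 0 < t → δ t '' S ⊆ S)
    {t : ℝ} (ht : 0 < t) : δ t '' S = S := by
  refine (hS t ht).antisymm fun x hx => ⟨δ t⁻¹ x, hS _ (inv_pos.2 ht) ⟨x, hx, rfl⟩, ?_⟩
  have h := hℓ.dilation_inv (inv_pos.2 ht) x
  rwa [inv_inv] at h

lemma isCone_closure (hℓ : IsHomogeneousGauge δ ℓ) (hS : IsCone δ S) : IsCone δ (closure S) := by
  refine ⟨hS.1.closure, fun t ht => ?_⟩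
  have h := (hℓ.dilationHomeomorph ht).image_closure S
  change δ t '' closure S = closure (δ t '' S) at h
  rw [h, hS.2 t ht]

lemma isCone_interior (hℓ : IsHomogeneousGauge δ ℓ) (hS : IsCone δ S)
    (h : (interior S).Nonempty) : IsCone δ (interior S) := by
  refine ⟨h, fun t ht => ?_⟩
  have h := (hℓ.dilationHomeomorph ht).image_interior S
  change δ t '' interior S = interior (δ t '' S) at h
  rw [h, hS.2 t ht]

lemma tendsto_dilation_zero (hℓ : IsHomogeneousGauge δ ℓ) (x : G) :
    Tendsto (fun t => δ t x) (𝓝[>] 0) (𝓝 1) := by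
  have h : Continuous fun t => dil δ t x := hℓ.continuous_dil.comp (Continuous.prodMk_left x)
  have h1 := h.tendsto 0
  rw [dil_of_nonpos δ le_rfl] at h1
  refine (h1.mono_left nhdsWithin_le_nhds).congr' ?_
  filter_upwards [self_mem_nhdsWithin] with t ht using dil_of_pos δ ht x

lemma one_mem_closure (hℓ : IsHomogeneousGauge δ ℓ) (hS : IsCone δ S) : (1 : G) ∈ closure S := by
  obtain ⟨x, hx⟩ := hS.1
  refine mem_closure_of_tendsto (hℓ.tendsto_dilation_zero x) ?_
  filter_upwards [self_mem_nhdsWithin] with t ht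
  rw [← hS.2 t ht]
  exact ⟨x, hx, rfl⟩

lemma image_setOf_lt (hℓ : IsHomogeneousGauge δ ℓ) {t : ℝ} (ht : 0 < t) (r : ℝ) :
    δ t '' {x | ℓ x < ENNReal.ofReal r} = {x | ℓ x < ENNReal.ofReal (t * r)} := by
  have ht' : ENNReal.ofReal t ≠ 0 := by simpa using ht
  have h : ∀ y, ℓ (δ t y) < ENNReal.ofReal (t * r) ↔ ℓ y < ENNReal.ofReal r := fun y => by
    rw [hℓ.dilation t ht, ENNReal.ofReal_mul ht.le]
    exact ENNReal.mul_lt_mul_iff_right ht' ENNReal.ofReal_ne_top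
  ext x
  constructor
  · rintro ⟨y, hy, rfl⟩
    exact (h y).2 hy
  · intro hx
    obtain ⟨y, rfl⟩ := (δ t).surjective x
    exact ⟨y, (h y).1 hx, rfl⟩

end Top

section Density

variable {G : Type*} [TopologicalSpace G] [Group G] [MeasurableSpace G] {μ : Measure G}
  [μ.IsHaarMeasure] {A S : Set G} {δ : ℝ → G ≃* G} {ℓ : G → ℝ≥0∞}

lemma measure_setOf_lt_ne_zero (hℓ : IsHomogeneousGauge δ ℓ) {r : ℝ} (hr : 0 < r) :
    μ {x | ℓ x < ENNReal.ofReal r} ≠ 0 :=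
  (Measure.measure_pos_of_mem_nhds μ (hℓ.mem_nhds r hr)).ne'

variable [IsTopologicalGroup G] [SecondCountableTopology G] [LocallyCompactSpace G] [BorelSpace G]

lemma exists_measure_image_dilation (hℓ : IsHomogeneousGauge δ ℓ) {t : ℝ} (ht : 0 < t) :
    ∃ c : ℝ≥0∞, c ≠ 0 ∧ c ≠ ⊤ ∧ ∀ Z, μ (δ t '' Z) = c * μ Z := by
  have h1 : Continuous (δ t).symm :=
    (hℓ.continuous_dilation (inv_pos.2 ht)).congr fun x => (hℓ.symm_apply ht x).symm
  have h2 : (μ.map (δ t).symm).IsHaarMeasure :=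
    (δ t).symm.isHaarMeasure_map μ h1 (hℓ.continuous_dilation ht)
  refine ⟨Measure.haarScalarFactor (μ.map (δ t).symm) μ, ?_, ENNReal.coe_ne_top, fun Z => ?_⟩
  · exact_mod_cast (Measure.haarScalarFactor_pos_of_isHaarMeasure _ _).ne'
  · have h3 := Measure.isMulLeftInvariant_eq_smul (μ.map (δ t).symm) μ
    have h4 : μ.map (δ t).symm Z = μ ((δ t).symm ⁻¹' Z) :=
      ((hℓ.dilationHomeomorph ht).symm.toMeasurableEquiv).map_apply Z
    rw [h3] at h4
    have h5 : δ t '' Z = (δ t).symm ⁻¹' Z := (δ t).toEquiv.image_eq_preimage_symm Z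
    rw [h5, ← h4]
    rfl

lemma measure_setOf_lt_ne_top (hℓ : IsHomogeneousGauge δ ℓ) {r : ℝ} (hr : 0 < r) :
    μ {x | ℓ x < ENNReal.ofReal r} ≠ ⊤ := by
  obtain ⟨K, hK, hK1⟩ := exists_compact_mem_nhds (1 : G)
  obtain ⟨ε, hε, h⟩ := hℓ.exists_lt_imp_mem K hK1
  obtain ⟨c, -, hc, hcZ⟩ := hℓ.exists_measure_image_dilation (μ := μ) (div_pos hr hε)
  have h1 := hcZ {x | ℓ x < ENNReal.ofReal ε}
  rw [hℓ.image_setOf_lt (div_pos hr hε), div_mul_cancel₀ _ hε.ne'] at h1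
  rw [h1]
  exact ENNReal.mul_ne_top hc ((measure_mono h).trans_lt hK.measure_lt_top).ne

/-- `A` has density `1` exactly at the points of its essential interior. At any other point `p`,
the complement of `A` contains almost all of `p * O`, for the cone `O = (interior S)⁻¹`;
by homogeneity this cone occupies a fixed positive proportion of each ball. -/
lemma tendsto_density_iff (hℓ : IsHomogeneousGauge δ ℓ) (hAm : MeasurableSet A) (hS : IsCone δ S)
    (hSi : (interior S).Nonempty) (hA : ∀ h ∈ S, μ (A \ (fun x => x * h) ⁻¹' A) = 0) (p : G) :
    Tendsto (fun r : ℝ => μ ({q | ℓ (p⁻¹ * q) < ENNReal.ofReal r} ∩ A) /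
      μ {q | ℓ (p⁻¹ * q) < ENNReal.ofReal r}) (𝓝[>] 0) (𝓝 1) ↔ p ∈ essInterior μ A := by
  have hball : ∀ r, μ {q | ℓ (p⁻¹ * q) < ENNReal.ofReal r} = μ {q | ℓ q < ENNReal.ofReal r} :=
    fun r => measure_preimage_mul μ p⁻¹ {q | ℓ q < ENNReal.ofReal r}
  simp only [hball]
  constructor
  · intro h
    by_contra hp
    set O : Set G := (interior S)⁻¹ with hO
    have hOo : IsOpen O := isOpen_interior.inv
    have hOc : IsCone δ O := by
      obtain ⟨s, hs⟩ := hSi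
      refine ⟨⟨s⁻¹, by simpa [hO] using hs⟩, fun t ht => ?_⟩
      rw [hO, image_inv, (hℓ.isCone_interior hS ⟨s, hs⟩).2 t ht]
    have hpO : ∀ q, p⁻¹ * q ∈ O → q ∈ essInterior μ Aᶜ := fun q hq => by
      have h1 := mul_mem_essInterior (A := Aᶜ) (p := p) hAm.compl hOo (μ := μ) (fun k hk => by
        have h2 := measure_diff_preimage_mul_right_compl (hA k⁻¹ (interior_subset hk))
        rwa [inv_inv] at h2) (by rwa [compl_compl]) hq
      rwa [mul_inv_cancel_left] at h1
    -- the proportion of the unit ball which is not occupied by the cone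
    set B : Set G := {q | ℓ q < ENNReal.ofReal 1} with hB
    have hB0 : μ B ≠ 0 := hℓ.measure_setOf_lt_ne_zero one_pos
    have hBt : μ B ≠ ⊤ := hℓ.measure_setOf_lt_ne_top one_pos
    have hκ : μ (B \ O) / μ B < 1 := by
      rw [ENNReal.div_lt_iff (Or.inl hB0) (Or.inl hBt), one_mul]
      refine lt_of_le_of_ne (measure_mono sdiff_subset) fun h1 => ?_
      have h2 := measure_inter_add_sdiff (μ := μ) B hOo.measurableSet
      rw [h1] at h2
      have h3 : μ (B ∩ O) = 0 := by
        refine (ENNReal.add_left_inj hBt).1 (h2.trans (zero_add _).symm)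
      obtain ⟨z, hz, hzO⟩ := mem_closure_iff_nhds.1 (hℓ.one_mem_closure hOc) _
        (interior_mem_nhds.2 (hℓ.mem_nhds 1 one_pos))
      exact (Measure.measure_pos_of_mem_nhds μ (inter_mem
        (mem_interior_iff_mem_nhds.1 hz) (hOo.mem_nhds hzO))).ne' h3
    refine not_le.2 hκ (le_of_tendsto h ?_)
    filter_upwards [self_mem_nhdsWithin] with r hr
    obtain ⟨c, hc0, hct, hc⟩ := hℓ.exists_measure_image_dilation (μ := μ) hr
    have h1 : {q | ℓ q < ENNReal.ofReal r} = δ r '' B := by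
      rw [hB, hℓ.image_setOf_lt hr, mul_one]
    have h2 : μ ({q | ℓ (p⁻¹ * q) < ENNReal.ofReal r} ∩ A) ≤ μ (δ r '' B \ O) := by
      have h3 : {q | ℓ (p⁻¹ * q) < ENNReal.ofReal r} ∩ A ⊆
          (fun q => p⁻¹ * q) ⁻¹' (δ r '' B \ O) ∪ (essInterior μ Aᶜ \ Aᶜ) := fun q hq => by
        by_cases hqO : p⁻¹ * q ∈ O
        · exact Or.inr ⟨hpO q hqO, fun h4 => h4 hq.2⟩
        · refine Or.inl ⟨?_, hqO⟩
          rw [← h1]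
          exact hq.1
      refine (measure_mono h3).trans ((measure_union_le _ _).trans_eq ?_)
      rw [measure_preimage_mul, measure_essInterior_diff, add_zero]
    have h3 : δ r '' B \ O = δ r '' (B \ O) := by
      rw [image_sdiff (δ r).injective, hOc.2 r hr]
    rw [h3] at h2
    rw [h1]
    refine (ENNReal.div_le_div_right h2 _).trans_eq ?_
    rw [hc, hc, ENNReal.mul_div_mul_left _ _ hc0 hct]
  · rintro ⟨U, hU, hU0⟩
    have h1 : (fun q => p * q) ⁻¹' U ∈ 𝓝 (1 : G) :=
      (continuous_const_mul p).continuousAt.preimage_mem_nhds (by simpa using hU)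
    obtain ⟨ε, hε, h⟩ := hℓ.exists_lt_imp_mem _ h1
    refine tendsto_const_nhds.congr' ?_
    filter_upwards [Ioo_mem_nhdsGT hε] with r hr
    have h2 : {q | ℓ (p⁻¹ * q) < ENNReal.ofReal r} ⊆ U := fun q hq => by
      have h3 := h _ (lt_of_lt_of_le hq (ENNReal.ofReal_le_ofReal hr.2.le))
      simpa using h3
    rw [measure_inter_conull' (measure_mono_null (sdiff_subset_sdiff_left h2) hU0), hball,
      ENNReal.div_self (hℓ.measure_setOf_lt_ne_zero hr.1) (hℓ.measure_setOf_lt_ne_top hr.1)]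

end Density

end IsHomogeneousGauge

section LieGroup

variable {E : Type*} [NormedAddCommGroup E] [NormedSpace ℝ E]
  {G : Type*} [TopologicalSpace G] [ChartedSpace E G] [Group G]

/-! ### Sets with constant normal are invariant almost everywhere -/

section ConstantNormal

variable [CompleteSpace E] [T2Space G] [LieGroup 𝓘(ℝ, E) ∞ G]
  [IsTopologicalGroup G] [MeasurableSpace G] [BorelSpace G] {μ : Measure G}
  [IsFiniteMeasureOnCompacts μ] {X : GroupLieAlgebra 𝓘(ℝ, E) G} {A : Set G}

/-- If `X 𝟙_A ≥ 0`, then the integral over `A` of a nonnegative test function decreases when the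
test function is composed with the flow of `X`. -/
lemma IsMonotone.setIntegral_mul_expCurve_le (hA : IsMonotone μ X A)
    {u : G → ℝ} (hu : ContMDiff 𝓘(ℝ, E) 𝓘(ℝ, ℝ) ∞ u) (hc : HasCompactSupport u)
    (h0 : ∀ g, 0 ≤ u g) {t : ℝ} (ht : 0 ≤ t) :
    ∫ g in A, u (g * expCurve X t) ∂μ ≤ ∫ g in A, u g ∂μ := by
  have hcs : ∀ (v : G → ℝ) (s : ℝ), HasCompactSupport v →
      HasCompactSupport fun g => v (g * expCurve X s) := fun v s hv =>
    hv.comp_homeomorph (Homeomorph.mulRight (expCurve X s))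
  have hwc : Continuous (lieDeriv X u) := continuous_lieDeriv hu X
  have hws := hasCompactSupport_lieDeriv hc X
  obtain ⟨M, hM⟩ := hwc.bounded_above_of_compact_support hws
  have hint : ∀ (v : G → ℝ) (s : ℝ), Continuous v → HasCompactSupport v →
      Integrable (fun g => v (g * expCurve X s)) (μ.restrict A) := fun v s hv hvc =>
    ((hv.comp (continuous_mul_const _)).integrable_of_hasCompactSupport (hcs v s hvc)).restrict
  have hderiv : ∀ s, HasDerivAt (fun s => ∫ g in A, u (g * expCurve X s) ∂μ)
      (∫ g in A, lieDeriv X u (g * expCurve X s) ∂μ) s := by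
    intro s
    set K : Set G := (fun z : G × ℝ => z.1 * (expCurve X z.2)⁻¹) ''
      (tsupport (lieDeriv X u) ×ˢ Icc (s - 1) (s + 1)) with hK
    have hKc : IsCompact K := (IsCompact.prod hws isCompact_Icc).image
      (continuous_fst.mul ((continuous_expCurve X).comp continuous_snd).inv)
    refine (hasDerivAt_integral_of_dominated_loc_of_deriv_le
      (F := fun s g => u (g * expCurve X s)) (F' := fun s g => lieDeriv X u (g * expCurve X s))
      (bound := K.indicator fun _ => M) (Icc_mem_nhds (sub_one_lt s) (lt_add_one s))
      (Eventually.of_forall fun r => (hint u r hu.continuous hc).aestronglyMeasurable)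
      (hint u s hu.continuous hc) (hint _ s hwc hws).aestronglyMeasurable
      (Eventually.of_forall fun g r hr => ?_) ?_
      (Eventually.of_forall fun g r _ => hasDerivAt_comp_mul_expCurve hu g X r)).2
    · by_cases hg : g * expCurve X r ∈ tsupport (lieDeriv X u)
      · have hgK : g ∈ K := ⟨(g * expCurve X r, r), ⟨hg, hr⟩, by simp⟩
        rw [indicator_of_mem hgK]
        exact hM _
      · rw [image_eq_zero_of_notMem_tsupport hg, norm_zero]
        exact indicator_nonneg (fun _ _ => (norm_nonneg _).trans (hM g)) g
    · refine Integrable.restrict ?_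
      exact (integrable_indicator_iff hKc.measurableSet).2
        (integrableOn_const hKc.measure_lt_top.ne)
  have hneg : ∀ s, ∫ g in A, lieDeriv X u (g * expCurve X s) ∂μ ≤ 0 := by
    intro s
    have h1 := hA (fun g => u (g * expCurve X s))
      (hu.comp (contMDiff_mul_right (I := 𝓘(ℝ, E)) (a := expCurve X s))) (hcs u s hc)
      fun g => h0 _
    simp only [lieDeriv_mul_expCurve hu] at h1
    linarith
  have hanti := antitone_of_hasDerivAt_nonpos hderiv hneg
  simpa [expCurve_zero] using hanti ht

variable [FiniteDimensional ℝ E] [SecondCountableTopology G] [LocallyCompactSpace G]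

lemma IsMonotone.measure_diff_preimage_expCurve (hA : IsMonotone μ X A) (hAm : MeasurableSet A)
    {t : ℝ} (ht : 0 ≤ t) : μ (A \ (fun x => x * expCurve X t) ⁻¹' A) = 0 := by
  set h := expCurve X t with hh
  by_contra hP
  have hPm : MeasurableSet (A \ (fun x => x * h) ⁻¹' A) :=
    hAm.diff ((continuous_mul_const h).measurable hAm)
  obtain ⟨K, hKP, hK, hK0⟩ := hPm.exists_lt_isCompact (pos_iff_ne_zero.2 hP)
  -- the translate `K * h` is disjoint from `A`, so that `A` has little mass near it
  set K' : Set G := (fun x => x * h) '' K with hK'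
  have hK'c : IsCompact K' := hK.image (continuous_mul_const h)
  have hK'A : Disjoint A K' := by
    rw [Set.disjoint_right]
    rintro _ ⟨x, hx, rfl⟩
    exact (hKP hx).2
  obtain ⟨U, hK'U, hUo, hU⟩ := K'.exists_isOpen_lt_of_lt (μ K' + μ K)
    (ENNReal.lt_add_right hK'c.measure_lt_top.ne hK0.ne')
  obtain ⟨L, hL, hK'L, hLU⟩ := exists_compact_between hK'c hUo hK'U
  obtain ⟨u, hu1, hu0, hu⟩ := exists_contMDiffMap_one_nhds_of_subset_interior (n := ⊤) 𝓘(ℝ, E)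
    hK'c.isClosed hK'L
  have hus : HasCompactSupport u := HasCompactSupport.intro hL hu0
  have huc : Continuous u := u.contMDiff.continuous
  have h1 := hA.setIntegral_mul_expCurve_le u.contMDiff hus (fun g => (hu g).1) ht
  have h2 : ∫ g in A, u g ∂μ ≤ μ.real (A ∩ L) := by
    rw [setIntegral_eq_of_subset_of_forall_sdiff_eq_zero hAm
      (inter_subset_left : A ∩ L ⊆ A) (fun x hx => hu0 x fun hxL => hx.2 ⟨hx.1, hxL⟩)]
    have hfin : μ (A ∩ L) ≠ ⊤ := ((measure_mono inter_subset_right).trans_lt hL.measure_lt_top).ne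
    calc ∫ g in A ∩ L, u g ∂μ ≤ ∫ g in A ∩ L, (1 : ℝ) ∂μ :=
          setIntegral_mono (huc.integrable_of_hasCompactSupport hus).integrableOn
            (integrableOn_const hfin) fun g => (hu g).2
      _ = μ.real (A ∩ L) := by simp
  have h3 : μ.real K ≤ ∫ g in A, u (g * h) ∂μ := by
    have hcs : HasCompactSupport fun g => u (g * h) :=
      hus.comp_homeomorph (Homeomorph.mulRight h)
    have hint : Integrable (fun g => u (g * h)) μ :=
      (huc.comp (continuous_mul_const h)).integrable_of_hasCompactSupport hcs
    calc μ.real K = ∫ g in K, (1 : ℝ) ∂μ := by simp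
      _ = ∫ g in K, u (g * h) ∂μ := setIntegral_congr_fun hK.measurableSet fun g hg =>
          (hu1.self_of_nhdsSet _ ⟨g, hg, rfl⟩).symm
      _ ≤ ∫ g in A, u (g * h) ∂μ := setIntegral_mono_set hint.integrableOn
          (Eventually.of_forall fun g => (hu _).1)
          (LE.le.eventuallyLE fun x hx => (hKP hx).1)
  have h4 : μ (A ∩ L) < μ K := by
    have h5 : μ (A ∩ L) + μ K' ≤ μ U := by
      rw [← measure_union (hK'A.mono_left inter_subset_left) hK'c.measurableSet]
      exact measure_mono (union_subset (inter_subset_right.trans hLU) hK'U)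
    have h6 := h5.trans_lt hU
    rw [add_comm] at h6
    exact (ENNReal.add_lt_add_iff_left hK'c.measure_lt_top.ne).1 h6
  have h5 : μ.real (A ∩ L) < μ.real K :=
    (ENNReal.toReal_lt_toReal h4.ne_top hK.measure_lt_top.ne).2 h4
  linarith

/-- A set with constant normal is almost everywhere invariant under the semigroup `S_W`. -/
lemma HasConstantNormal.measure_diff_preimage [μ.IsMulLeftInvariant]
    {W : Set (GroupLieAlgebra 𝓘(ℝ, E) G)} (hA : HasConstantNormal μ W A) (hAm : MeasurableSet A)
    {h : G} (hh : h ∈ semigroupGen W) : μ (A \ (fun x => x * h) ⁻¹' A) = 0 := by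
  induction hh using Subsemigroup.closure_induction with
  | mem x hx =>
    rw [expSet_eq] at hx
    obtain ⟨X, hX, rfl⟩ := hx
    exact (hA.2 X hX).measure_diff_preimage_expCurve hAm zero_le_one
  | mul x y _ _ hx hy =>
    rw [← measure_mul_right_null μ x] at hy
    refine measure_mono_null (fun z hz => ?_) (measure_union_null hx hy)
    by_cases hzx : z * x ∈ A
    · exact Or.inr ⟨hzx, fun h => hz.2 (by simpa [mul_assoc] using h)⟩
    · exact Or.inl ⟨hz.1, hzx⟩

end ConstantNormal

end LieGroup

/-! ### Contractibility of sets with a cone property -/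

namespace IsHomogeneousGauge

variable {G : Type*} [TopologicalSpace G] [Group G] {δ : ℝ → G ≃* G} {ℓ : G → ℝ≥0∞}

lemma dil_dil (hℓ : IsHomogeneousGauge δ ℓ) {s : ℝ} (hs : 0 < s) (t : ℝ) (x : G) :
    dil δ s (dil δ t x) = dil δ (s * t) x := by
  rcases lt_or_ge 0 t with ht | ht
  · rw [dil_of_pos δ ht, dil_of_pos δ hs, dil_of_pos δ (mul_pos hs ht),
      hℓ.dilation_dilation s t hs ht]
  · rw [dil_of_nonpos δ ht, dil_of_nonpos δ (mul_nonpos_of_nonneg_of_nonpos hs.le ht), map_one]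

lemma gauge_one (hℓ : IsHomogeneousGauge δ ℓ) : ℓ 1 = 0 := by
  have h := hℓ.dilation 2 two_pos 1
  rw [map_one] at h
  by_contra h0
  have h1 : 1 * ℓ 1 = ENNReal.ofReal 2 * ℓ 1 := by rw [one_mul]; exact h
  have h2 := (ENNReal.mul_left_inj h0 (hℓ.ne_top 1)).1 h1
  norm_num at h2

lemma dil_apply (hℓ : IsHomogeneousGauge δ ℓ) (t : ℝ) (x : G) :
    ℓ (dil δ t x) = ENNReal.ofReal t * ℓ x := by
  rcases lt_or_ge 0 t with ht | ht
  · rw [dil_of_pos δ ht, hℓ.dilation t ht]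
  · rw [dil_of_nonpos δ ht, hℓ.gauge_one, ENNReal.ofReal_of_nonpos ht, zero_mul]

/-- A homogeneous gauge is continuous; as it need not be symmetric, both a small increment and its
inverse have to be used. -/
lemma continuous_toReal [IsTopologicalGroup G] (hℓ : IsHomogeneousGauge δ ℓ) :
    Continuous fun x => (ℓ x).toReal := by
  refine continuous_iff_continuousAt.2 fun x => Metric.tendsto_nhds.2 fun ε hε => ?_
  have h1 : ∀ᶠ y in 𝓝 x, ℓ (x⁻¹ * y) < ENNReal.ofReal ε := by
    have h : ContinuousAt (fun y => x⁻¹ * y) x := by fun_prop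
    exact h.eventually_mem (s := {z | ℓ z < ENNReal.ofReal ε}) (by simpa using hℓ.mem_nhds ε hε)
  have h2 : ∀ᶠ y in 𝓝 x, ℓ (y⁻¹ * x) < ENNReal.ofReal ε := by
    have h : ContinuousAt (fun y => y⁻¹ * x) x := by fun_prop
    exact h.eventually_mem (s := {z | ℓ z < ENNReal.ofReal ε}) (by simpa using hℓ.mem_nhds ε hε)
  have key : ∀ a b : G, ℓ (a⁻¹ * b) < ENNReal.ofReal ε → (ℓ b).toReal < (ℓ a).toReal + ε := by
    intro a b hab
    have h3 := hℓ.mul_le a (a⁻¹ * b)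
    rw [mul_inv_cancel_left] at h3
    have h4 := ENNReal.toReal_mono (ENNReal.add_ne_top.2 ⟨hℓ.ne_top _, hℓ.ne_top _⟩) h3
    rw [ENNReal.toReal_add (hℓ.ne_top _) (hℓ.ne_top _)] at h4
    have h5 := (ENNReal.lt_ofReal_iff_toReal_lt (hℓ.ne_top _)).1 hab
    linarith
  filter_upwards [h1, h2] with y hy hy'
  rw [Real.dist_eq, abs_sub_lt_iff]
  constructor <;> linarith [key _ _ hy, key _ _ hy']

/-- A nonempty set which is stable under right multiplication by a cone with interior points is
contractible. Let `h` be an interior point of the cone and `p` a point of the set. The contraction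
moves `x` along `x * δ_s h` up to the time `s = T x`, then along
`p * δ_s (p⁻¹ * x) * δ_(T x) h` with `s` decreasing from `1` to `0`, and finally along `p * δ_s h`
to `p * h`. If `T x` is large compared with `ℓ (p⁻¹ * x)`, then `δ_s (p⁻¹ * x) * δ_(T x) h` belongs
to the cone for all `s ≤ 1`, because the cone contains `B * h` for some ball `B` around the
identity. -/
lemma contractibleSpace [IsTopologicalGroup G] (hℓ : IsHomogeneousGauge δ ℓ) {F C : Set G}
    (hC : ∀ t, 0 < t → δ t '' C ⊆ C) (hCi : (interior C).Nonempty) (hF : F.Nonempty)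
    (hFC : F * C ⊆ F) : ContractibleSpace F := by
  obtain ⟨p, hp⟩ := hF
  obtain ⟨h, hh⟩ := hCi
  have hD := hℓ.continuous_dil
  have h1 : (fun y => y * h) ⁻¹' C ∈ 𝓝 (1 : G) :=
    (continuous_mul_const h).continuousAt.preimage_mem_nhds
      (by simpa using mem_interior_iff_mem_nhds.1 hh)
  obtain ⟨ε, hε, hεC⟩ := hℓ.exists_lt_imp_mem _ h1
  have hDC : ∀ t, 0 < t → ∀ y ∈ C, dil δ t y ∈ C := fun t ht y hy => by
    rw [dil_of_pos δ ht]; exact hC t ht ⟨y, hy, rfl⟩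
  have hhC : h ∈ C := interior_subset hh
  let T : F → ℝ := fun x => 1 + (ℓ (p⁻¹ * x)).toReal / ε
  have hT : Continuous T := continuous_const.add
    ((hℓ.continuous_toReal.comp (continuous_const.mul continuous_subtype_val)).div_const ε)
  have hT0 : ∀ x, 0 < T x := fun x => by positivity
  -- the estimate which makes the choice of `T` work
  have hseg : ∀ x : F, ∀ s ≤ (1 : ℝ), dil δ s (p⁻¹ * x) * dil δ (T x) h ∈ C := by
    intro x s hs
    have h2 : dil δ ((T x)⁻¹ * s) (p⁻¹ * x) * h ∈ C := by
      refine hεC _ ?_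
      rw [hℓ.dil_apply]
      rw [ENNReal.lt_ofReal_iff_toReal_lt (ENNReal.mul_ne_top ENNReal.ofReal_ne_top (hℓ.ne_top _)),
        ENNReal.toReal_mul, ENNReal.toReal_ofReal']
      have h3 : 0 ≤ (ℓ (p⁻¹ * x)).toReal := ENNReal.toReal_nonneg
      have h4 : max ((T x)⁻¹ * s) 0 ≤ (T x)⁻¹ :=
        max_le (mul_le_of_le_one_right (inv_pos.2 (hT0 x)).le hs) (inv_pos.2 (hT0 x)).le
      refine (mul_le_mul_of_nonneg_right h4 h3).trans_lt ?_
      rw [inv_mul_lt_iff₀ (hT0 x)]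
      have h5 : T x * ε = ε + (ℓ (p⁻¹ * x)).toReal := by
        simp only [T]; field_simp
      linarith
    have h3 := hDC (T x) (hT0 x) _ h2
    rwa [map_mul, hℓ.dil_dil (hT0 x), mul_inv_cancel_left₀ (hT0 x).ne'] at h3
  have hmem : ∀ x ∈ F, ∀ y ∈ C, x * y ∈ F := fun x hx y hy => hFC (mul_mem_mul hx hy)
  have c1 : Continuous fun z : unitInterval × F => (z.2 : G) * dil δ (z.1 * T z.2) h := by
    refine (continuous_subtype_val.comp continuous_snd).mul (hD.comp (Continuous.prodMk ?_
      continuous_const))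
    exact (continuous_subtype_val.comp continuous_fst).mul (hT.comp continuous_snd)
  have c2 : Continuous fun z : unitInterval × F =>
      p * (dil δ z.1 (p⁻¹ * z.2) * dil δ (T z.2) h) := by
    refine continuous_const.mul ((hD.comp (Continuous.prodMk ?_ ?_)).mul
      (hD.comp (Continuous.prodMk ?_ continuous_const)))
    · exact continuous_subtype_val.comp continuous_fst
    · exact continuous_const.mul (continuous_subtype_val.comp continuous_snd)
    · exact hT.comp continuous_snd
  have c3 : Continuous fun z : unitInterval × F =>
      p * dil δ ((1 - (z.1 : ℝ)) * T z.2 + z.1) h := by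
    refine continuous_const.mul (hD.comp (Continuous.prodMk ?_ continuous_const))
    have h2 : Continuous fun z : unitInterval × F => (z.1 : ℝ) :=
      continuous_subtype_val.comp continuous_fst
    exact ((continuous_const.sub h2).mul (hT.comp continuous_snd)).add h2
  have m1 : ∀ z : unitInterval × F, (z.2 : G) * dil δ (z.1 * T z.2) h ∈ F := fun z => by
    rcases z.1.2.1.eq_or_lt with h0 | h0
    · rw [← h0, zero_mul, dil_of_nonpos δ le_rfl, mul_one]; exact z.2.2
    · exact hmem _ z.2.2 _ (hDC _ (mul_pos h0 (hT0 _)) _ hhC)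
  have m2 : ∀ z : unitInterval × F, p * (dil δ z.1 (p⁻¹ * z.2) * dil δ (T z.2) h) ∈ F :=
    fun z => hmem _ hp _ (hseg _ _ z.1.2.2)
  have m3 : ∀ z : unitInterval × F, p * dil δ ((1 - (z.1 : ℝ)) * T z.2 + z.1) h ∈ F := fun z => by
    refine hmem _ hp _ (hDC _ ?_ _ hhC)
    rcases z.1.2.1.eq_or_lt with h0 | h0
    · rw [← h0]; simpa using hT0 z.2
    · have := mul_nonneg (sub_nonneg.2 z.1.2.2) (hT0 z.2).le
      linarith
  let f₁ : C(unitInterval × F, F) := ⟨fun z => ⟨_, m1 z⟩, c1.subtype_mk m1⟩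
  let f₂ : C(unitInterval × F, F) := ⟨fun z => ⟨_, m2 z⟩, c2.subtype_mk m2⟩
  let f₃ : C(unitInterval × F, F) := ⟨fun z => ⟨_, m3 z⟩, c3.subtype_mk m3⟩
  let g₁ : C(F, F) := ⟨fun x => f₂ (1, x), f₂.continuous.comp (Continuous.prodMk_right 1)⟩
  let g₂ : C(F, F) := ⟨fun x => f₂ (0, x), f₂.continuous.comp (Continuous.prodMk_right 0)⟩
  have d1 : ∀ x, dil δ 1 x = x := fun x => by rw [dil_of_pos δ one_pos, hℓ.dilation_one]
  have H1 : (ContinuousMap.id F).Homotopic g₁ := ⟨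
    { toContinuousMap := f₁
      map_zero_left := fun x => Subtype.ext (by
        simp [f₁, dil_of_nonpos δ le_rfl])
      map_one_left := fun x => Subtype.ext (by
        simp [f₁, f₂, g₁, d1, ← mul_assoc]) }⟩
  have H2 : g₂.Homotopic g₁ := ⟨
    { toContinuousMap := f₂
      map_zero_left := fun x => rfl
      map_one_left := fun x => rfl }⟩
  have H3 : g₂.Homotopic (ContinuousMap.const F ⟨p * h, hmem _ hp _ hhC⟩) := ⟨
    { toContinuousMap := f₃
      map_zero_left := fun x => Subtype.ext (by
        simp [f₃, f₂, g₂, dil_of_nonpos δ le_rfl])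
      map_one_left := fun x => Subtype.ext (by
        simp [f₃, d1]) }⟩
  rw [contractible_iff_id_nullhomotopic]
  exact ⟨_, H1.trans (H2.symm.trans H3)⟩

end IsHomogeneousGauge

end Carnot

theorem mainTheorem1
    {E : Type*} [NormedAddCommGroup E] [NormedSpace ℝ E] [FiniteDimensional ℝ E]
    {G : Type*} [TopologicalSpace G] [T2Space G] [SecondCountableTopology G]
    [SimplyConnectedSpace G] [ChartedSpace E G] [Group G] [LieGroup 𝓘(ℝ, E) ∞ G]
    [MeasurableSpace G] [BorelSpace G] (μ : Measure G) [μ.IsHaarMeasure]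
    (V : ℕ → Submodule ℝ (GroupLieAlgebra 𝓘(ℝ, E) G)) (hV : Carnot.IsStratification V)
    (δ : ℝ → G ≃* G) (hδ : Carnot.IsDilationFamily V δ)
    (ip : InnerProductSpace.Core ℝ (V 1))
    (W : Set (GroupLieAlgebra 𝓘(ℝ, E) G)) (hW : Carnot.IsHorizontalHalfSpace V W)
    (A : Set G) (hA : Carnot.HasConstantNormal μ W A) :
    (Carnot.IsCone δ (Carnot.semigroupGen W : Set G) ∧
      (interior (Carnot.semigroupGen W : Set G)).Nonempty) ∧
    Carnot.HasConeProperty δ (closure (Carnot.semigroupGen W : Set G))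
      (Carnot.carnotLebesgueRep V ip μ A) ∧
    Carnot.IsRegularlyOpen (Carnot.carnotLebesgueRep V ip μ A) ∧
    (μ A ≠ 0 → ContractibleSpace (Carnot.carnotLebesgueRep V ip μ A)) ∧
    (μ Aᶜ ≠ 0 → ContractibleSpace ((Carnot.carnotLebesgueRep V ip μ A)ᶜ : Set G)) := by
  have : CompleteSpace E := FiniteDimensional.complete ℝ E
  have : IsTopologicalGroup G := topologicalGroup_of_lieGroup 𝓘(ℝ, E) ∞
  have : LocallyCompactSpace G := Manifold.locallyCompact_of_finiteDimensional 𝓘(ℝ, E)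
  have hℓ := Carnot.isHomogeneousGauge_carnotDist hδ hV hW ip
  set S : Set G := (Carnot.semigroupGen W : Set G) with hS
  have hSi : (interior S).Nonempty := Carnot.interior_semigroupGen_nonempty hV hW
  have hSc : Carnot.IsCone δ S := ⟨⟨1, hW.one_mem⟩, fun t ht =>
    hℓ.image_eq_of_forall_subset (fun t ht => hδ.image_semigroupGen_subset hW ht) ht⟩
  -- all notions depend on `A` only up to a null set, so that `A` may be assumed to be measurable
  obtain ⟨A', hA'm, hAA'⟩ : ∃ A', MeasurableSet A' ∧ A =ᵐ[μ] A' :=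
    ⟨toMeasurable μ A, measurableSet_toMeasurable μ A, hA.1.toMeasurable_ae_eq.symm⟩
  have hA' : Carnot.HasConstantNormal μ W A' := by
    refine ⟨hA'm.nullMeasurableSet, fun X hX u hu hc h0 => ?_⟩
    rw [← Measure.restrict_congr_set hAA']
    exact hA.2 X hX u hu hc h0
  have hinv : ∀ h ∈ S, μ (A' \ (fun x => x * h) ⁻¹' A') = 0 :=
    fun h hh => hA'.measure_diff_preimage hA'm hh
  have hrep : Carnot.carnotLebesgueRep V ip μ A = Carnot.essInterior μ A' := by
    ext p
    rw [← hℓ.tendsto_density_iff hA'm hSc hSi hinv p]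
    have hball : ∀ r, Carnot.carnotBall V ip p r =
        {q | Carnot.carnotDist V ip 1 (p⁻¹ * q) < ENNReal.ofReal r} := fun r => by
      ext q
      simp only [Carnot.carnotBall, mem_ofPred_eq, Carnot.carnotDist_eq_one_inv_mul p q]
    simp only [Carnot.carnotLebesgueRep, mem_ofPred_eq, hball,
      measure_congr ((ae_eq_refl _).inter hAA')]
  have hopen : IsOpen (Carnot.essInterior μ A') := Carnot.isOpen_essInterior
  have hmul : Carnot.essInterior μ A' * S ⊆ Carnot.essInterior μ A' :=
    Carnot.essInterior_mul_subset hinv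
  rw [hrep]
  refine ⟨⟨hSc, hSi⟩, ⟨hℓ.isCone_closure hSc, Carnot.mul_closure_subset hopen hmul⟩,
    Carnot.isRegularlyOpen_essInterior hA'm hinv
      (hℓ.one_mem_closure (hℓ.isCone_interior hSc hSi)), fun h => ?_, fun h => ?_⟩
  · rw [measure_congr hAA'] at h
    exact hℓ.contractibleSpace (fun t ht => (hSc.2 t ht).subset) hSi
      (Carnot.essInterior_nonempty hA'm hSi hinv h) hmul
  · rw [measure_congr hAA'.compl] at h
    refine hℓ.contractibleSpace (C := S⁻¹) (fun t ht => ?_) ?_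
      (nonempty_compl.2 (Carnot.essInterior_ne_univ h)) (Carnot.compl_mul_inv_subset hmul)
    · rw [image_inv, hSc.2 t ht]
    · exact hSi.inv.mono
        (interior_maximal (Set.inv_subset_inv.2 interior_subset) isOpen_interior.inv)
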